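/- Conventions. $M$ is a smooth manifold of dimension $4n+3$, $(a,b,c)$ denotes any cyclic permutation of $(1,2,3)$, and $d\eta(X,Y)=X\eta(Y)-Y\eta(X)-\eta([X,Y])$ for a one-form $\eta$. A *hyper CR structure* on $M$ consists of two smooth corank one subbundles $Q_1,Q_2\subset TM$, transversal to each other, with smooth complex structures $I_1=I$ on $Q_1$ and $I_2=J$ on $Q_2$ such that $IJ=-JI$ on $I(Q_1\cap Q_2)\cap J(Q_1\cap Q_2)$. They determine a third pair by $Q_3=I(Q_1\cap Q_2)+J(Q_1\cap Q_2)$ and $I_3=K=-JI$ on $I(Q_1\cap Q_2)$, $K=IJ$ on $J(Q_1\cap Q_2)$. With $Q=Q_1\cap Q_2\cap Q_3$ (of corank three), the structure is required to be integrable: for all $X,Y\in\Gamma(Q)$ and $a=1,2,3$, $[X,Y]-[I_aX,I_aY]\in\Gamma(Q_a)$ and $I_a([X,Y]-[I_aX,I_aY])-[X,I_aY]-[I_aX,Y]\in\Gamma(Q)$. A smooth one-form $\theta=(\theta_1,\theta_2,\theta_3)$ with values in $\mathbb R^3$ is *compatible* if $\ker\theta_a=Q_a$ and $\theta_c\circ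 I_a=\theta_b$ on $Q_a$. Its Levi form on $Q$ is $\mathrm{Levi}_\theta(X,Y)=\tfrac12\big(d\theta_1(X,IY)+d\theta_1(JX,KY)\big)$, and $h(X,Y)=(2n+4)\,\mathrm{Levi}_\theta(X,Y)-\sum_{a=1}^3 d\theta_a(X,I_aY)$ for $X,Y\in Q$. The structure is *ultra-pseudoconvex* if $h$ is positive or negative definite on $Q$ for some compatible form; $\theta$ is *pseudohermitian* if it is compatible and $g=\mathrm{Levi}_\theta$ is positive definite. An *admissible triple* is a triple of smooth vector fields $T_1,T_2,T_3$ transverse to $Q$ with $T_a\in\Gamma(Q_b\cap Q_c)$ and $I_aT_b=T_c$; normalize it by $\theta_a(T_a)=1$. Put $Q^\perp=\mathrm{span}(T_1,T_2,T_3)$, so that $TM=Q\oplus Q^\perp$, and $g^\perp=\theta_1^2+\theta_2^2+\theta_3^2$. The *associated connection* is the connection $\nabla$ on $TM$ that preserves $Q$ and $Q^\perp$, makes $g$ on $Q$ and $g^\perp$ on $Q^\perp$ parallel, and whose torsion satisfies, for $X,Y\in Q$ and $U,V\in Q^\perp$: $\mathrm{Tor}(X,Y)_Q=0$; $\mathrm{Tor}(U,V)_{Q^\perp}=0$;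 $X\mapsto \mathrm{Tor}(U,X)_Q$ is $g$-symmetric; $U\mapsto\mathrm{Tor}(U,X)_{Q^\perp}$ is $g^\perp$-symmetric. Let $\omega$ be the $so(4n)$-valued connection matrix of $\nabla|_Q$, restricted to directions in $Q$, in a local $g$-orthonormal frame of $Q$ of the form $(\varepsilon_k,I\varepsilon_k,J\varepsilon_k,K\varepsilon_k)_{1\le k\le n}$, and let $\omega^{\mathrm{obs}}$ be its component in $(sp(n)+sp(1))^\perp\subset so(4n)$. At each point $\omega^{\mathrm{obs}}$ is an element of the $Sp(n)\times Sp(1)$-module $(\mathbb H^n)^*\otimes(sp(n)+sp(1))^\perp$. The *canonical triple* of $\theta$ is the normalized admissible triple for which the isotypic component $\omega^{E\otimes H}$ of $\omega^{\mathrm{obs}}$ vanishes everywhere; here $E\otimes H\cong\mathbb H^n\otimes\mathbb C$ is the standard complex module ($E=\mathbb C^{2n}$, $H=\mathbb C^2$). **Proposition.** Let $M$ have dimension $4n+3>7$ and carry an ultra-pseudoconvex hyper CR structure with a pseudohermitian structure $\theta$. Let $f$ be a smooth real function on $M$, $\theta'=e^{2f}\theta$, and let $(T_1,T_2,T_3)$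 and $(T_1',T_2',T_3')$ be the canonical triples of $\theta$ and $\theta'$. Then there is a unique section $W$ of $Q$ with $$h(W,X)=-(2n+1)\,df(X)\qquad\text{for all }X\in Q,$$ where $h$ is formed with $\theta$; it is smooth, and $$T_a'=e^{-2f}\,(T_a+2I_aW),\qquad a=1,2,3.$$ -/

import Mathlib

open Set Filter Topology VectorField
open scoped Manifold ContDiff Matrix Kronecker

noncomputable section

/-! ### Vector fields, one-forms and distributions on a `(4n+3)`-manifold -/

section Fields

variable (n : ℕ) (M : Type*) [TopologicalSpace M]
  [ChartedSpace (EuclideanSpace ℝ (Fin (4 * n + 3))) M]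

/-- (Not necessarily smooth) vector fields on the `(4n+3)`-dimensional manifold `M`. -/
abbrev VField : Type _ := (x : M) → TangentSpace (𝓡 (4 * n + 3)) x

/-- (Not necessarily smooth) real one-forms on `M`. -/
abbrev OneForm : Type _ := (x : M) → (TangentSpace (𝓡 (4 * n + 3)) x →L[ℝ] ℝ)

/-- Fields of linear subspaces of the tangent spaces of `M`. -/
abbrev SubspaceField : Type _ := (x : M) → Submodule ℝ (TangentSpace (𝓡 (4 * n + 3)) x)

variable {n M}

/-- The vector field `X` is smooth on `U`. -/
def VField.SmoothOn [IsManifold (𝓡 (4 * n + 3)) ∞ M] (X : VField n M) (U : Set M) : Prop :=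
  ContMDiffOn (𝓡 (4 * n + 3)) (𝓡 (4 * n + 3)).tangent ∞
    (fun x => (⟨x, X x⟩ : TangentBundle (𝓡 (4 * n + 3)) M)) U

/-- The one-form `η` is smooth on `U`, as a section of the cotangent bundle. -/
def OneForm.SmoothOn [IsManifold (𝓡 (4 * n + 3)) ∞ M] (η : OneForm n M) (U : Set M) : Prop :=
  ContMDiffOn (𝓡 (4 * n + 3))
    ((𝓡 (4 * n + 3)).prod 𝓘(ℝ, EuclideanSpace ℝ (Fin (4 * n + 3)) →L[ℝ] ℝ)) ∞
    (fun x => Bundle.TotalSpace.mk' (EuclideanSpace ℝ (Fin (4 * n + 3)) →L[ℝ] ℝ)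
      (E := fun x : M => TangentSpace (𝓡 (4 * n + 3)) x →L[ℝ] Bundle.Trivial M ℝ x) x (η x)) U

/-- `X` is a smooth section of `Q` over the set `U`, i.e. `X ∈ Γ(Q|_U)`. -/
def IsSectionOn [IsManifold (𝓡 (4 * n + 3)) ∞ M] (Q : SubspaceField n M) (X : VField n M) (U : Set M) : Prop :=
  X.SmoothOn U ∧ ∀ x ∈ U, X x ∈ Q x

/-- The exterior derivative `dη` at `x`, evaluated on `u, v ∈ T_xM`: the form is pulled back to the
model space by the inverse of the chart at `x`, and differentiated there. The convention is
`dη(X,Y) = X η(Y) - Y η(X) - η([X,Y])`. -/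
def OneForm.d (η : OneForm n M) (x : M) (u v : TangentSpace (𝓡 (4 * n + 3)) x) : ℝ :=
  let φ := extChartAt (𝓡 (4 * n + 3)) x
  let ηhat : EuclideanSpace ℝ (Fin (4 * n + 3)) → (EuclideanSpace ℝ (Fin (4 * n + 3)) →L[ℝ] ℝ) :=
    fun y => (η (φ.symm y)).comp
      (mfderiv 𝓘(ℝ, EuclideanSpace ℝ (Fin (4 * n + 3))) (𝓡 (4 * n + 3)) φ.symm y)
  let dφ : TangentSpace (𝓡 (4 * n + 3)) x →L[ℝ] EuclideanSpace ℝ (Fin (4 * n + 3)) :=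
    mfderiv (𝓡 (4 * n + 3)) 𝓘(ℝ, EuclideanSpace ℝ (Fin (4 * n + 3))) φ x
  extDeriv (fun y => ContinuousAlternatingMap.ofSubsingleton ℝ
    (EuclideanSpace ℝ (Fin (4 * n + 3))) ℝ (0 : Fin 1) (ηhat y)) (φ x) ![dφ u, dφ v]

end Fields

/-! ### Almost CR structures and hyper CR structures -/

section Structures

variable (n : ℕ) (M : Type*) [TopologicalSpace M]
  [ChartedSpace (EuclideanSpace ℝ (Fin (4 * n + 3))) M] [IsManifold (𝓡 (4 * n + 3)) ∞ M]

/-- An almost CR structure on `M`: a smooth corank one subbundle `Q` of `TM` with a smooth complex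
structure `J : Q → Q`. Here `J` is written as a field of endomorphisms of `TM`, but only its
restriction to `Q` has a meaning; it is never used outside `Q`. -/
structure AlmostCRStructure where
  Q : SubspaceField n M
  J : (x : M) → TangentSpace (𝓡 (4 * n + 3)) x →ₗ[ℝ] TangentSpace (𝓡 (4 * n + 3)) x
  corank_one : ∀ x₀ : M, ∃ U : Set M, IsOpen U ∧ x₀ ∈ U ∧ ∃ η : OneForm n M, η.SmoothOn U ∧
    ∀ x ∈ U, η x ≠ 0 ∧ ∀ v, v ∈ Q x ↔ η x v = 0
  J_mem : ∀ x, ∀ v ∈ Q x, J x v ∈ Q x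
  J_sq : ∀ x, ∀ v ∈ Q x, J x (J x v) = -v
  J_smooth : ∀ (U : Set M) (X : VField n M), IsOpen U → IsSectionOn Q X U →
    VField.SmoothOn (fun x => J x (X x)) U

/-- An almost hyper CR structure: a pair `(Q₁, I) = cr 0`, `(Q₂, J) = cr 1` of almost CR structures,
with `Q₁`, `Q₂` transversal and `IJ = -JI` on `I(Q₁ ∩ Q₂) ∩ J(Q₁ ∩ Q₂)`. The third almost CR
structure `(Q₃, K) = cr 2` is the one that the pair determines:
`Q₃ = I(Q₁ ∩ Q₂) + J(Q₁ ∩ Q₂)`, `K = -JI` on `I(Q₁ ∩ Q₂)` and `K = IJ` on `J(Q₁ ∩ Q₂)`. -/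
structure AlmostHyperCRStructure where
  cr : Fin 3 → AlmostCRStructure n M
  transversal : ∀ x, (cr 0).Q x ⊔ (cr 1).Q x = ⊤
  anticomm : ∀ x, ∀ v ∈ ((cr 0).Q x ⊓ (cr 1).Q x).map ((cr 0).J x) ⊓
      ((cr 0).Q x ⊓ (cr 1).Q x).map ((cr 1).J x),
    (cr 0).J x ((cr 1).J x v) = -(cr 1).J x ((cr 0).J x v)
  third_Q : ∀ x, (cr 2).Q x = ((cr 0).Q x ⊓ (cr 1).Q x).map ((cr 0).J x) ⊔
      ((cr 0).Q x ⊓ (cr 1).Q x).map ((cr 1).J x)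
  third_J_left : ∀ x, ∀ v ∈ ((cr 0).Q x ⊓ (cr 1).Q x).map ((cr 0).J x),
    (cr 2).J x v = -(cr 1).J x ((cr 0).J x v)
  third_J_right : ∀ x, ∀ v ∈ ((cr 0).Q x ⊓ (cr 1).Q x).map ((cr 1).J x),
    (cr 2).J x v = (cr 0).J x ((cr 1).J x v)

variable {n M}

/-- The corank three subbundle `Q = Q₁ ∩ Q₂ ∩ Q₃`. -/
def AlmostHyperCRStructure.Q (S : AlmostHyperCRStructure n M) : SubspaceField n M :=
  fun x => ⨅ a, (S.cr a).Q x

/-- The endomorphism `I_a` at `x`, for `a = 0, 1, 2` (meaningful on `Q_a` only). -/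
abbrev AlmostHyperCRStructure.I (S : AlmostHyperCRStructure n M) (a : Fin 3) (x : M) :
    TangentSpace (𝓡 (4 * n + 3)) x →ₗ[ℝ] TangentSpace (𝓡 (4 * n + 3)) x :=
  (S.cr a).J x

variable (n M)

/-- A hyper CR structure: an integrable almost hyper CR structure. The conditions are imposed on
local smooth sections of `Q`. -/
structure HyperCRStructure extends AlmostHyperCRStructure n M where
  integrable_mem : ∀ (a : Fin 3) (U : Set M) (X Y : VField n M), IsOpen U →
    IsSectionOn toAlmostHyperCRStructure.Q X U → IsSectionOn toAlmostHyperCRStructure.Q Y U →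
    ∀ x ∈ U,
      mlieBracket (𝓡 (4 * n + 3)) X Y x
        - mlieBracket (𝓡 (4 * n + 3)) (fun y => toAlmostHyperCRStructure.I a y (X y))
            (fun y => toAlmostHyperCRStructure.I a y (Y y)) x ∈ (cr a).Q x
  integrable_J : ∀ (a : Fin 3) (U : Set M) (X Y : VField n M), IsOpen U →
    IsSectionOn toAlmostHyperCRStructure.Q X U → IsSectionOn toAlmostHyperCRStructure.Q Y U →
    ∀ x ∈ U,
      toAlmostHyperCRStructure.I a x (mlieBracket (𝓡 (4 * n + 3)) X Y x
        - mlieBracket (𝓡 (4 * n + 3)) (fun y => toAlmostHyperCRStructure.I a y (X y))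
            (fun y => toAlmostHyperCRStructure.I a y (Y y)) x)
        - mlieBracket (𝓡 (4 * n + 3)) X (fun y => toAlmostHyperCRStructure.I a y (Y y)) x
        - mlieBracket (𝓡 (4 * n + 3)) (fun y => toAlmostHyperCRStructure.I a y (X y)) Y x
        ∈ toAlmostHyperCRStructure.Q x

end Structures

namespace HyperCRStructure

variable {n : ℕ} {M : Type*} [TopologicalSpace M]
  [ChartedSpace (EuclideanSpace ℝ (Fin (4 * n + 3))) M] [IsManifold (𝓡 (4 * n + 3)) ∞ M]
  (S : HyperCRStructure n M)

/-- A smooth `ℝ³`-valued one-form `θ` is compatible with the structure if `ker θ_a = Q_a` and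
`θ_c ∘ I_a = θ_b` on `Q_a` for every cyclic permutation `(a,b,c)`. -/
structure IsCompatible (θ : Fin 3 → OneForm n M) : Prop where
  smooth : ∀ a, (θ a).SmoothOn univ
  ker_eq : ∀ a x v, θ a x v = 0 ↔ v ∈ (S.cr a).Q x
  comp_eq : ∀ (a : Fin 3) (x : M), ∀ v ∈ (S.cr a).Q x, θ (a + 2) x (S.I a x v) = θ (a + 1) x v

/-- The Levi form `Levi_θ(X,Y) = ½ (dθ₁(X, IY) + dθ₁(JX, KY))` on `Q`. -/
def levi (θ : Fin 3 → OneForm n M) (x : M) (u v : TangentSpace (𝓡 (4 * n + 3)) x) : ℝ :=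
  (1 / 2) * ((θ 0).d x u (S.I 0 x v) + (θ 0).d x (S.I 1 x u) (S.I 2 x v))

/-- The form `h(X,Y) = (2n+4) Levi_θ(X,Y) - ∑ₐ dθ_a(X, I_a Y)` on `Q`. -/
def h (θ : Fin 3 → OneForm n M) (x : M) (u v : TangentSpace (𝓡 (4 * n + 3)) x) : ℝ :=
  (2 * n + 4) * S.levi θ x u v - ∑ a, (θ a).d x u (S.I a x v)

/-- Ultra-pseudoconvexity: `h` is positive or negative definite on `Q` for some compatible form. -/
def IsUltraPseudoconvex : Prop :=
  ∃ θ : Fin 3 → OneForm n M, S.IsCompatible θ ∧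
    ((∀ x, ∀ v ∈ S.Q x, v ≠ 0 → 0 < S.h θ x v v) ∨ (∀ x, ∀ v ∈ S.Q x, v ≠ 0 → S.h θ x v v < 0))

/-- `θ` is a pseudohermitian structure: a compatible form with positive definite Levi form. -/
def IsPseudohermitian (θ : Fin 3 → OneForm n M) : Prop :=
  S.IsCompatible θ ∧ ∀ x, ∀ v ∈ S.Q x, v ≠ 0 → 0 < S.levi θ x v v

/-- An admissible triple of vector fields: each `T_a` is smooth, transverse to `Q`, a section of
`Q_b ∩ Q_c`, and `I_a T_b = T_c` for every cyclic permutation `(a,b,c)`. -/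
structure IsAdmissibleTriple (T : Fin 3 → VField n M) : Prop where
  smooth : ∀ a, (T a).SmoothOn univ
  transverse : ∀ a x, T a x ∉ S.Q x
  mem_left : ∀ a x, T a x ∈ (S.cr (a + 1)).Q x
  mem_right : ∀ a x, T a x ∈ (S.cr (a + 2)).Q x
  I_apply : ∀ a x, S.I a x (T (a + 1) x) = T (a + 2) x

end HyperCRStructure

section Splitting

variable {n : ℕ} {M : Type*} [TopologicalSpace M]
  [ChartedSpace (EuclideanSpace ℝ (Fin (4 * n + 3))) M]

/-- The three-plane field `Q^⊥` spanned by `T₁, T₂, T₃`. -/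
def Qperp (T : Fin 3 → VField n M) : SubspaceField n M :=
  fun x => Submodule.span ℝ (range fun a => T a x)

/-- The `Q^⊥`-component of `v`, when `θ_a(T_b) = δ_ab`. -/
def perpPart (θ : Fin 3 → OneForm n M) (T : Fin 3 → VField n M) (x : M)
    (v : TangentSpace (𝓡 (4 * n + 3)) x) : TangentSpace (𝓡 (4 * n + 3)) x :=
  ∑ a, θ a x v • T a x

/-- The `Q`-component of `v`, when `θ_a(T_b) = δ_ab`. -/
def QPart (θ : Fin 3 → OneForm n M) (T : Fin 3 → VField n M) (x : M)
    (v : TangentSpace (𝓡 (4 * n + 3)) x) : TangentSpace (𝓡 (4 * n + 3)) x :=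
  v - perpPart θ T x v

/-- The form `g^⊥ = θ₁² + θ₂² + θ₃²`. -/
def gperp (θ : Fin 3 → OneForm n M) (x : M) (u v : TangentSpace (𝓡 (4 * n + 3)) x) : ℝ :=
  ∑ a, θ a x u * θ a x v

end Splitting

/-! ### The model `Sp(n)·Sp(1)`-module -/

namespace QuatModel

/-- The indices `(k, r)` of an adapted basis `ε_{k,0}, ε_{k,1} = I ε_{k,0}, ε_{k,2} = J ε_{k,0},
ε_{k,3} = K ε_{k,0}` of the quaternionic `n`-space. -/
abbrev Idx (n : ℕ) : Type := Fin n × Fin 4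

/-- The matrices of `I, J, K` in the basis `ε₀, Iε₀, Jε₀, Kε₀` of a quaternionic line. -/
def quatUnit : Fin 3 → Matrix (Fin 4) (Fin 4) ℝ :=
  ![!![0, -1, 0, 0; 1, 0, 0, 0; 0, 0, 0, -1; 0, 0, 1, 0],
    !![0, 0, -1, 0; 0, 0, 0, 1; 1, 0, 0, 0; 0, -1, 0, 0],
    !![0, 0, 0, -1; 0, 0, -1, 0; 0, 1, 0, 0; 1, 0, 0, 0]]

/-- The matrices of `I, J, K` in an adapted basis of the quaternionic `n`-space. -/
def I (n : ℕ) (a : Fin 3) : Matrix (Idx n) (Idx n) ℝ :=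
  (1 : Matrix (Fin n) (Fin n) ℝ) ⊗ₖ quatUnit a

/-- The Lie algebra `sp(n)` in `so(4n)`: skew matrices that commute with `I, J, K`. -/
def sp (n : ℕ) : Submodule ℝ (Matrix (Idx n) (Idx n) ℝ) where
  carrier := {A | Aᵀ = -A ∧ ∀ a, A * I n a = I n a * A}
  zero_mem' := by simp
  add_mem' := by
    rintro A B ⟨hA, hA'⟩ ⟨hB, hB'⟩
    refine ⟨?_, fun a => ?_⟩
    · rw [Matrix.transpose_add, hA, hB, neg_add]
    · rw [add_mul, mul_add, hA', hB']
  smul_mem' := by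
    rintro c A ⟨hA, hA'⟩
    refine ⟨?_, fun a => ?_⟩
    · rw [Matrix.transpose_smul, hA, smul_neg]
    · rw [smul_mul_assoc, mul_smul_comm, hA']

/-- The Lie algebra `sp(1)` in `so(4n)`: the span of `I, J, K`. -/
def sp1 (n : ℕ) : Submodule ℝ (Matrix (Idx n) (Idx n) ℝ) :=
  Submodule.span ℝ (range (I n))

/-- The complement `(sp(n) + sp(1))^⊥` in `so(4n)`; the Killing form of `so(4n)` is
`(4n-2) tr(AB)`, a positive multiple of the trace form used here. -/
def obs (n : ℕ) : Set (Matrix (Idx n) (Idx n) ℝ) :=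
  {A | Aᵀ = -A ∧ ∀ B ∈ sp n ⊔ sp1 n, (A * B).trace = 0}

/-- The matrices of the elements of `Sp(n)`: orthogonal and commuting with `I, J, K`. -/
def SpGroup (n : ℕ) : Set (Matrix (Idx n) (Idx n) ℝ) :=
  {A | Aᵀ * A = 1 ∧ ∀ a, A * I n a = I n a * A}

/-- The matrices of the elements of `Sp(1)`, the unit quaternions `c + ∑ₐ dₐ Iₐ`. -/
def Sp1Group (n : ℕ) : Set (Matrix (Idx n) (Idx n) ℝ) :=
  {B | ∃ (c : ℝ) (d : Fin 3 → ℝ), c ^ 2 + ∑ a, d a ^ 2 = 1 ∧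
    B = c • (1 : Matrix (Idx n) (Idx n) ℝ) + ∑ a, d a • I n a}

/-- Elements of `(ℝ^{4n})^* ⊗ gl(4n)`, given by their values `w k` on the basis vectors. -/
abbrev Tensor (n : ℕ) : Type := Idx n → Matrix (Idx n) (Idx n) ℝ

/-- The action `(g·w)(x) = g w(g⁻¹x) g⁻¹` of an orthogonal matrix `g`. -/
def act {n : ℕ} (g : Matrix (Idx n) (Idx n) ℝ) (w : Tensor n) : Tensor n :=
  fun k => ∑ l, g k l • (g * w l * gᵀ)

/-- `L` is an `Sp(n) × Sp(1)`-equivariant linear map to the quaternionic `n`-space `ℍⁿ = ℝ^{4n}`,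
the real irreducible module whose complexification is `E ⊗ H`. -/
def IsIntertwiner {n : ℕ} (L : Tensor n →ₗ[ℝ] (Idx n → ℝ)) : Prop :=
  ∀ A ∈ SpGroup n, ∀ B ∈ Sp1Group n, ∀ w : Tensor n, L (act (A * B) w) = (A * B) *ᵥ L w

/-- The `E ⊗ H`-component of the tensor `w` vanishes: by complete reducibility and Schur's lemma,
the isotypic component of `w` of the type of an irreducible module is zero if and only if every
equivariant map to that module kills `w`. For `w` with values in `(sp(n) + sp(1))^⊥` it makes no
difference whether the maps are defined on all tensors or only on those with values in
`(sp(n) + sp(1))^⊥`, since the latter form an invariant subspace with an invariant complement. -/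
def EHComponentVanishes {n : ℕ} (w : Tensor n) : Prop :=
  ∀ L : Tensor n →ₗ[ℝ] (Idx n → ℝ), IsIntertwiner L → L w = 0

end QuatModel

/-! ### The connection of an admissible triple, and the canonical triple -/

namespace HyperCRStructure

variable {n : ℕ} {M : Type*} [TopologicalSpace M]
  [ChartedSpace (EuclideanSpace ℝ (Fin (4 * n + 3))) M] [IsManifold (𝓡 (4 * n + 3)) ∞ M]
  (S : HyperCRStructure n M)

/-- A connection on `TM`; `cov Y x v` is `∇_v Y` at `x`. -/
abbrev Connection (n : ℕ) (M : Type*) [TopologicalSpace M]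
    [ChartedSpace (EuclideanSpace ℝ (Fin (4 * n + 3))) M] [IsManifold (𝓡 (4 * n + 3)) ∞ M] :
    Type _ :=
  CovariantDerivative (𝓡 (4 * n + 3)) (EuclideanSpace ℝ (Fin (4 * n + 3)))
    (fun x : M => TangentSpace (𝓡 (4 * n + 3)) x)

/-- The conditions that characterize the connection associated with the pseudohermitian structure
`θ` and the admissible three-plane field `Q^⊥` spanned by `T` (where `θ_a(T_a) = 1`):
`Q` and `Q^⊥` are preserved, `g = Levi_θ` on `Q` and `g^⊥` on `Q^⊥` are parallel, and for
`X, Y ∈ Q` and `U, V ∈ Q^⊥` one has `Tor(X,Y)_Q = 0`, `Tor(U,V)_{Q^⊥} = 0`, the map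
`X ↦ Tor(U,X)_Q` is `g`-symmetric and `U ↦ Tor(U,X)_{Q^⊥}` is `g^⊥`-symmetric. -/
structure IsAssociatedConnection (θ : Fin 3 → OneForm n M) (T : Fin 3 → VField n M)
    (cov : Connection n M) : Prop where
  smooth : cov.ContMDiffCovariantDerivative ∞
  preserves_Q : ∀ (O : Set M) (Y : VField n M), IsOpen O → IsSectionOn S.Q Y O →
    ∀ x ∈ O, ∀ v, cov Y x v ∈ S.Q x
  preserves_Qperp : ∀ (O : Set M) (V : VField n M), IsOpen O → IsSectionOn (Qperp T) V O →
    ∀ x ∈ O, ∀ v, cov V x v ∈ Qperp T x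
  parallel_g : ∀ (O : Set M) (Y Z : VField n M), IsOpen O → IsSectionOn S.Q Y O →
    IsSectionOn S.Q Z O → ∀ x ∈ O, ∀ v : TangentSpace (𝓡 (4 * n + 3)) x,
      mvfderiv (𝓡 (4 * n + 3)) (fun y => S.levi θ y (Y y) (Z y)) x v
        = S.levi θ x (cov Y x v) (Z x) + S.levi θ x (Y x) (cov Z x v)
  parallel_gperp : ∀ (O : Set M) (V W : VField n M), IsOpen O → IsSectionOn (Qperp T) V O →
    IsSectionOn (Qperp T) W O → ∀ x ∈ O, ∀ v : TangentSpace (𝓡 (4 * n + 3)) x,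
      mvfderiv (𝓡 (4 * n + 3)) (fun y => gperp θ y (V y) (W y)) x v
        = gperp θ x (cov V x v) (W x) + gperp θ x (V x) (cov W x v)
  torsion_Q : ∀ x, ∀ u ∈ S.Q x, ∀ v ∈ S.Q x, QPart θ T x (cov.torsion x u v) = 0
  torsion_Qperp : ∀ x, ∀ u ∈ Qperp T x, ∀ v ∈ Qperp T x, perpPart θ T x (cov.torsion x u v) = 0
  torsion_symm_Q : ∀ x, ∀ t ∈ Qperp T x, ∀ u ∈ S.Q x, ∀ v ∈ S.Q x,
    S.levi θ x (QPart θ T x (cov.torsion x t u)) v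
      = S.levi θ x u (QPart θ T x (cov.torsion x t v))
  torsion_symm_Qperp : ∀ x, ∀ u ∈ S.Q x, ∀ s ∈ Qperp T x, ∀ t ∈ Qperp T x,
    gperp θ x (perpPart θ T x (cov.torsion x s u)) t
      = gperp θ x s (perpPart θ T x (cov.torsion x t u))

/-- `ε` is a smooth adapted orthonormal frame of `Q` over `O`: it is orthonormal for `Levi_θ`, and
`ε_{k,1} = I ε_{k,0}`, `ε_{k,2} = J ε_{k,0}`, `ε_{k,3} = K ε_{k,0}`. -/
structure IsAdaptedFrameOn (θ : Fin 3 → OneForm n M) (ε : QuatModel.Idx n → VField n M)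
    (O : Set M) : Prop where
  isSection : ∀ i, IsSectionOn S.Q (ε i) O
  orthonormal : ∀ x ∈ O, ∀ i j, S.levi θ x (ε i x) (ε j x) = if i = j then 1 else 0
  quaternionic : ∀ x ∈ O, ∀ (k : Fin n) (a : Fin 3), ε (k, a.succ) x = S.I a x (ε (k, 0) x)

/-- The connection matrix at `x` of the `Q`-partial connection with respect to the orthonormal frame
`ε`: `∇_{ε_k} ε_j = ∑ᵢ ω(ε_k)_{ij} ε_i`, that is, `ω(ε_k)_{ij} = g(∇_{ε_k} ε_j, ε_i)`. -/
def connectionMatrix (θ : Fin 3 → OneForm n M) (cov : Connection n M)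
    (ε : QuatModel.Idx n → VField n M) (x : M) : QuatModel.Tensor n :=
  fun k => Matrix.of fun i j => S.levi θ x (cov (ε j) x (ε k x)) (ε i x)

/-- The condition `ω^{E⊗H} = 0`: at every point, for an adapted frame near that point (any two of
them give the same `ω^{obs}`, up to the action of `Sp(n)`), the `(sp(n) + sp(1))^⊥`-component
`ω^{obs}` of the connection matrix `ω`, restricted to `Q`, has no `E ⊗ H`-component. -/
def EHObstructionVanishes (θ : Fin 3 → OneForm n M) (cov : Connection n M) : Prop :=
  ∀ x : M, ∃ (O : Set M) (ε : QuatModel.Idx n → VField n M) (ωobs : QuatModel.Tensor n),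
    IsOpen O ∧ x ∈ O ∧ S.IsAdaptedFrameOn θ ε O ∧
    (∀ k, ωobs k ∈ QuatModel.obs n ∧
      S.connectionMatrix θ cov ε x k - ωobs k ∈ QuatModel.sp n ⊔ QuatModel.sp1 n) ∧
    QuatModel.EHComponentVanishes ωobs

/-- `T` is the canonical triple of the pseudohermitian structure `θ`: it is admissible, normalized
by `θ_a(T_a) = 1`, and its associated connection satisfies `ω^{E⊗H} = 0`. -/
def IsCanonicalTriple (θ : Fin 3 → OneForm n M) (T : Fin 3 → VField n M) : Prop :=
  S.IsAdmissibleTriple T ∧ (∀ a x, θ a x (T a x) = 1) ∧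
    ∃ cov : Connection n M, S.IsAssociatedConnection θ T cov ∧ S.EHObstructionVanishes θ cov

end HyperCRStructure

end

/-! The section W exists before any equation is solved. Normalization forces e^{2f}T'_a - T_a into
Q, and the relations I_a T_b = T_c make these three differences equal to 2 I_a W for a single smooth
section W (`IsAdmissibleTriple.exists_section`). What has to be shown is that the two canonical
conditions impose h(W,·) = -(2n+1) df, and that h is nondegenerate.

Let D be the difference of the connection matrices on Q of the two associated connections, in a
frame orthonormal for Levi_θ. Since e^{2f} Levi_θ is parallel for the second connection, the
symmetric part of D is df ⊗ g. Since the Q-part of both torsions vanishes on Q, D_X Y - D_Y X = 2 ∑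
dθ_a(X,Y) I_a W. As for the Koszul formula, these two facts determine D, linearly in df and W
(`connectionMatrix_sub`).

The condition ω^{E⊗H} = 0 is used through one intertwiner to ℍⁿ, `contraction`, built from a
projection that kills sp(n) + sp(1). It therefore kills the full connection matrix of each
connection in a suitable adapted frame. It also does so for the second connection in the frame of θ:
up to scale the transition matrix lies in Sp(n), and the inhomogeneous term commutes with I, J, K
(`contraction_eq_zero`). Hence the contraction of D is zero.

To evaluate it, let G_a be the matrix of dθ_a(X, I_a Y). Integrability gives G_a - I_b G_a I_b = 2
for b ≠ a (`levi_identity`), and then `contraction_difference` yields 6(n-1) (∑ G_a W - (2n+4) W -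
(2n+1) df). The bracket is -(h(W,·) + (2n+1) df), and n > 1 allows division.

For uniqueness, compatible forms are pointwise proportional and h scales with the form, so
definiteness for one form gives nondegeneracy for all (`IsUltraPseudoconvex.eq_zero`). -/

section ExteriorDerivative

variable {n : ℕ} {M : Type*} [TopologicalSpace M]
  [ChartedSpace (EuclideanSpace ℝ (Fin (4 * n + 3))) M] [IsManifold (𝓡 (4 * n + 3)) ∞ M]

local notation "𝔼" => EuclideanSpace ℝ (Fin (4 * n + 3))

/-! ### Exterior derivatives and Lie brackets -/

theorem VField.SmoothOn.mdifferentiableAt {X : VField n M} {U : Set M} (hX : X.SmoothOn U)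
    (hU : IsOpen U) {x : M} (hx : x ∈ U) :
    MDifferentiableAt (𝓡 (4 * n + 3)) (𝓡 (4 * n + 3)).tangent
      (fun y => (⟨y, X y⟩ : TangentBundle (𝓡 (4 * n + 3)) M)) x :=
  ((hX x hx).contMDiffAt (hU.mem_nhds hx)).mdifferentiableAt (by simp)

/-- The pullback of a smooth one-form to a chart is differentiable. -/
theorem OneForm.SmoothOn.differentiableAt_chart {η : OneForm n M} {U : Set M}
    (hη : η.SmoothOn U) (hU : IsOpen U) {x : M} (hx : x ∈ U) :
    DifferentiableAt ℝ (fun y : 𝔼 => (η ((extChartAt (𝓡 (4 * n + 3)) x).symm y)).comp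
      (mfderiv 𝓘(ℝ, 𝔼) (𝓡 (4 * n + 3)) (extChartAt (𝓡 (4 * n + 3)) x).symm y) : 𝔼 → (𝔼 →L[ℝ] ℝ))
      (extChartAt (𝓡 (4 * n + 3)) x x) := by
  have : IsManifold (𝓡 (4 * n + 3)) 1 M := IsManifold.of_le (n := ∞) (by simp)
  have h1 := ((hη x hx).contMDiffAt (hU.mem_nhds hx)).mdifferentiableAt (by simp)
  rw [mdifferentiableAt_hom_bundle] at h1
  have h2 := h1.2
  have h3 : MDifferentiableAt 𝓘(ℝ, 𝔼) (𝓡 (4 * n + 3)) (extChartAt (𝓡 (4 * n + 3)) x).symm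
      (extChartAt (𝓡 (4 * n + 3)) x x) := by
    have := mdifferentiableWithinAt_extChartAt_symm (I := 𝓡 (4 * n + 3))
      (mem_extChartAt_target (I := 𝓡 (4 * n + 3)) x)
    simpa [mdifferentiableWithinAt_univ] using this
  have h4 := MDifferentiableAt.comp_of_eq (extChartAt (𝓡 (4 * n + 3)) x x) h2 h3 (by simp)
  have h5 := mdifferentiableAt_iff_differentiableAt.1 h4
  refine h5.congr_of_eventuallyEq ?_
  have hT : (extChartAt (𝓡 (4 * n + 3)) x).target ∈ 𝓝 (extChartAt (𝓡 (4 * n + 3)) x x) :=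
    extChartAt_target_mem_nhds x
  filter_upwards [hT] with y hy
  have hy' : (extChartAt (𝓡 (4 * n + 3)) x).symm y ∈ (chartAt 𝔼 x).source := by
    simpa using (extChartAt (𝓡 (4 * n + 3)) x).map_target hy
  -- In the trivialization of the cotangent bundle at x, the form is exactly its pullback by the
  -- inverse chart, so smoothness as a section gives the claim.
  have h6 := TangentBundle.symmL_trivializationAt (I := 𝓡 (4 * n + 3)) (𝕜 := ℝ) hy'
  rw [(extChartAt (𝓡 (4 * n + 3)) x).right_inv hy] at h6
  simp only [Function.comp, ContinuousLinearMap.inCoordinates, h6]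
  ext v
  simp [mfderivWithin_univ]

/-- `dη(X, Y) = -η([X, Y])` for vector fields `X`, `Y` in the kernel of `η`. -/
theorem OneForm.SmoothOn.d_apply_of_ker {η : OneForm n M} {U : Set M} (hη : η.SmoothOn U)
    (hU : IsOpen U) {x : M} (hx : x ∈ U) {X Y : VField n M} (hX : X.SmoothOn U)
    (hY : Y.SmoothOn U) (hηX : ∀ y ∈ U, η y (X y) = 0) (hηY : ∀ y ∈ U, η y (Y y) = 0) :
    η.d x (X x) (Y x) = -η x (mlieBracket (𝓡 (4 * n + 3)) X Y x) := by
  have : IsManifold (𝓡 (4 * n + 3)) 1 M := IsManifold.of_le (n := ∞) (by simp)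
  have : IsManifold (𝓡 (4 * n + 3)) 2 M := IsManifold.of_le (n := ∞) (by norm_cast)
  set φ := extChartAt (𝓡 (4 * n + 3)) x with hφ
  let pull : VField n M → 𝔼 → 𝔼 := fun Z =>
    mpullbackWithin 𝓘(ℝ, 𝔼) (𝓡 (4 * n + 3)) φ.symm Z (range (𝓡 (4 * n + 3)))
  have hpull : ∀ Z : VField n M, Z.SmoothOn U → DifferentiableAt ℝ (pull Z) (φ x) := by
    intro Z hZ
    have := ((hZ.mdifferentiableAt hU hx).mdifferentiableWithinAt
      (s := univ)).differentiableWithinAt_mpullbackWithin_vectorField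
    have h : ∀ s : Set 𝔼, s = univ → DifferentiableWithinAt ℝ (pull Z) s (φ x) →
        DifferentiableAt ℝ (pull Z) (φ x) := by
      rintro s rfl hs
      exact differentiableWithinAt_univ.1 hs
    exact h _ (by simp) this
  have hT : φ.target ∈ 𝓝 (φ x) := extChartAt_target_mem_nhds x
  have hinv : ∀ y ∈ φ.target, (mfderiv 𝓘(ℝ, 𝔼) (𝓡 (4 * n + 3)) φ.symm y).IsInvertible := by
    intro y hy
    have := isInvertible_mfderivWithin_extChartAt_symm (I := 𝓡 (4 * n + 3)) hy
    simpa only [ModelWithCorners.range_eq_univ, mfderivWithin_univ] using this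
  let ηhat : 𝔼 → (𝔼 →L[ℝ] ℝ) := fun y =>
    (η (φ.symm y)).comp (mfderiv 𝓘(ℝ, 𝔼) (𝓡 (4 * n + 3)) φ.symm y)
  have hηhat : DifferentiableAt ℝ ηhat (φ x) := hη.differentiableAt_chart hU hx
  have hηpull : ∀ Z : VField n M, ∀ y ∈ φ.target, ηhat y (pull Z y) = η (φ.symm y) (Z (φ.symm y)) := by
    intro Z y hy
    have h1 := ContinuousLinearMap.IsInvertible.self_apply_inverse (hinv y hy) (Z (φ.symm y))
    simp only [ηhat, pull, mpullbackWithin_apply, ModelWithCorners.range_eq_univ,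
      mfderivWithin_univ]
    exact congrArg _ h1
  -- The functions η(X) and η(Y) vanish near the point and not merely at it, so the two derivative
  -- terms of the formula for dη drop out.
  have hzero : ∀ Z : VField n M, (∀ y ∈ U, η y (Z y) = 0) →
      (fun y => ηhat y (pull Z y)) =ᶠ[𝓝 (φ x)] fun _ => 0 := by
    intro Z hZ
    have hcont : ContinuousAt φ.symm (φ x) := continuousAt_extChartAt_symm x
    have hU' : φ.symm ⁻¹' U ∈ 𝓝 (φ x) :=
      hcont.preimage_mem_nhds (by rw [hφ, extChartAt_to_inv]; exact hU.mem_nhds hx)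
    filter_upwards [hT, hU'] with y hy hy'
    rw [hηpull Z y hy, hZ _ hy']
  have hφx : φ x ∈ φ.target := mem_extChartAt_target x
  let A : 𝔼 →L[ℝ] 𝔼 := mfderiv (𝓡 (4 * n + 3)) 𝓘(ℝ, 𝔼) φ x
  let B : 𝔼 →L[ℝ] 𝔼 := mfderiv 𝓘(ℝ, 𝔼) (𝓡 (4 * n + 3)) φ.symm (φ x)
  have hBA : ∀ v : 𝔼, B (A v) = v := by
    intro v
    have h1 := mfderivWithin_extChartAt_symm_comp_mfderiv_extChartAt' (I := 𝓡 (4 * n + 3))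
      (mem_extChartAt_source (I := 𝓡 (4 * n + 3)) x)
    rw [ModelWithCorners.range_eq_univ, mfderivWithin_univ] at h1
    exact DFunLike.congr_fun h1 v
  have hdφ : ∀ Z : VField n M, A (Z x) = pull Z (φ x) := by
    intro Z
    have h2 : B (pull Z (φ x)) = Z (φ.symm (φ x)) := by
      have := ContinuousLinearMap.IsInvertible.self_apply_inverse (hinv (φ x) hφx) (Z (φ.symm (φ x)))
      simp only [pull, mpullbackWithin_apply, ModelWithCorners.range_eq_univ, mfderivWithin_univ]
      exact this
    have h3 : B (pull Z (φ x)) = Z x :=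
      h2.trans (congrArg (fun p => (Z p : 𝔼)) (extChartAt_to_inv (I := 𝓡 (4 * n + 3)) x))
    exact (hinv (φ x) hφx).injective ((hBA (Z x)).trans h3.symm)
  have hbr : η x (mlieBracket (𝓡 (4 * n + 3)) X Y x)
      = ηhat (φ x) (lieBracket ℝ (pull X) (pull Y) (φ x)) := by
    set w := lieBracket ℝ (pull X) (pull Y) (φ x) with hw
    have hA : (mfderiv (𝓡 (4 * n + 3)) 𝓘(ℝ, 𝔼) φ x).IsInvertible :=
      isInvertible_mfderiv_extChartAt (mem_extChartAt_source x)
    have h1 : mlieBracket (𝓡 (4 * n + 3)) X Y x = (mfderiv (𝓡 (4 * n + 3)) 𝓘(ℝ, 𝔼) φ x).inverse w := by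
      have h : ∀ s : Set 𝔼, s = univ → lieBracketWithin ℝ (pull X) (pull Y) s (φ x) = w := by
        rintro s rfl
        rw [lieBracketWithin_univ]
      rw [← mlieBracketWithin_univ, mlieBracketWithin_apply]
      exact congrArg _ (h _ (by simp))
    have h2 : B w = (mfderiv (𝓡 (4 * n + 3)) 𝓘(ℝ, 𝔼) φ x).inverse w := by
      have h3 : A ((mfderiv (𝓡 (4 * n + 3)) 𝓘(ℝ, 𝔼) φ x).inverse w) = w :=
        ContinuousLinearMap.IsInvertible.self_apply_inverse hA w
      have h4 := hBA ((mfderiv (𝓡 (4 * n + 3)) 𝓘(ℝ, 𝔼) φ x).inverse w)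
      rw [h3] at h4
      exact h4
    rw [h1]
    have h5 : ηhat (φ x) w = (η x : 𝔼 →L[ℝ] ℝ) (B w) :=
      congrArg (fun p => (η p : 𝔼 →L[ℝ] ℝ) (B w)) (extChartAt_to_inv (I := 𝓡 (4 * n + 3)) x)
    rw [h5, h2]
  let om : 𝔼 → 𝔼 [⋀^Fin 1]→L[ℝ] ℝ := fun y =>
    ContinuousAlternatingMap.ofSubsingleton ℝ 𝔼 ℝ (0 : Fin 1) (ηhat y)
  have hdiff : DifferentiableAt ℝ om (φ x) :=
    ((ContinuousAlternatingMap.ofSubsingletonLIE (𝕜 := ℝ) (E := 𝔼) (F := ℝ) (0 : Fin 1)).toContinuousLinearEquiv.toContinuousLinearMap.differentiableAt).comp _ hηhat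
  have key := extDeriv_apply_vectorField (n := 0) (x := φ x) (V := ![pull X, pull Y]) hdiff (by
    intro i; fin_cases i
    · exact hpull X hX
    · exact hpull Y hY)
  have e1 : fderiv ℝ (fun y => ηhat y (pull X y)) (φ x) = 0 := by
    rw [(hzero X hηX).fderiv_eq]; simp
  have e2 : fderiv ℝ (fun y => ηhat y (pull Y y)) (φ x) = 0 := by
    rw [(hzero Y hηY).fderiv_eq]; simp
  have hvec : (fun i => (![pull X, pull Y] : Fin 2 → 𝔼 → 𝔼) i (φ x))
      = ![A (X x), A (Y x)] := by
    ext1 i; fin_cases i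
    · exact (hdφ X).symm
    · exact (hdφ Y).symm
  have key2 : extDeriv om (φ x) ![A (X x), A (Y x)]
      = -ηhat (φ x) (lieBracket ℝ (pull X) (pull Y) (φ x)) := by
    rw [← hvec]
    refine Eq.trans key ?_
    simp [om, Fin.removeNth, Fin.succAbove, e1, e2, Fin.sum_univ_two]
  rw [hbr, ← key2]
  rfl

end ExteriorDerivative

/-! ### Quaternion matrices and an equivariant contraction to ℍⁿ -/

namespace QuatModel

variable {n : ℕ}

theorem sum_fin_three_cyclic {β : Type*} [AddCommMonoid β] (f : Fin 3 → β) (a : Fin 3) :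
    ∑ b, f b = f a + f (a + 1) + f (a + 2) := by
  fin_cases a <;> simp [Fin.sum_univ_three] <;> abel

section Units

theorem quatUnit_mul_self (a : Fin 3) : quatUnit a * quatUnit a = -1 := by
  ext i j
  fin_cases a <;> fin_cases i <;> fin_cases j <;> simp [quatUnit]

theorem quatUnit_mul_succ (a : Fin 3) : quatUnit a * quatUnit (a + 1) = quatUnit (a + 2) := by
  ext i j
  fin_cases a <;> fin_cases i <;> fin_cases j <;> simp [quatUnit]

theorem quatUnit_succ_mul (a : Fin 3) : quatUnit (a + 1) * quatUnit a = -quatUnit (a + 2) := by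
  ext i j
  fin_cases a <;> fin_cases i <;> fin_cases j <;> simp [quatUnit]

theorem quatUnit_transpose (a : Fin 3) : (quatUnit a)ᵀ = -quatUnit a := by
  ext i j
  fin_cases a <;> fin_cases i <;> fin_cases j <;> simp [quatUnit]

theorem I_mul_self (a : Fin 3) : I n a * I n a = -1 := by
  rw [I, ← Matrix.mul_kronecker_mul, quatUnit_mul_self, one_mul, ← neg_one_smul ℝ (1 : Matrix (Fin 4) (Fin 4) ℝ),
    Matrix.kronecker_smul, Matrix.one_kronecker_one, neg_one_smul]

theorem I_mul_succ (a : Fin 3) : I n a * I n (a + 1) = I n (a + 2) := by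
  simp only [I, ← Matrix.mul_kronecker_mul, quatUnit_mul_succ, one_mul]

theorem I_succ_mul (a : Fin 3) : I n (a + 1) * I n a = -I n (a + 2) := by
  simp only [I, ← Matrix.mul_kronecker_mul, quatUnit_succ_mul, one_mul]
  rw [← neg_one_smul ℝ (quatUnit _), Matrix.kronecker_smul, neg_one_smul]

theorem I_transpose (a : Fin 3) : (I n a)ᵀ = -I n a := by
  rw [I, ← Matrix.kroneckerMap_transpose, quatUnit_transpose, Matrix.transpose_one,
    ← neg_one_smul ℝ (quatUnit _), Matrix.kronecker_smul, neg_one_smul]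

theorem trace_I (a : Fin 3) : (I n a).trace = 0 := by
  have h := Matrix.trace_transpose (I n a)
  rw [I_transpose, Matrix.trace_neg] at h
  linarith

theorem I_anticomm {a b : Fin 3} (hab : a ≠ b) : I n a * I n b = -(I n b * I n a) := by
  have h : b = a + 1 ∨ a = b + 1 := by revert a b; decide
  rcases h with rfl | rfl
  · rw [I_mul_succ, I_succ_mul, neg_neg]
  · rw [I_mul_succ, I_succ_mul]

theorem I_mul_I_mul_self {a b : Fin 3} (hab : a ≠ b) : I n a * I n b * I n a = I n b := by
  rw [I_anticomm hab, neg_mul, mul_assoc, I_mul_self, mul_neg, mul_one, neg_neg]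

theorem exists_I_mul_I {a b : Fin 3} (hab : a ≠ b) :
    ∃ c, c ≠ a ∧ c ≠ b ∧ (I n a * I n b = I n c ∨ I n a * I n b = -I n c) := by
  have h : b = a + 1 ∨ a = b + 1 := by revert a b; decide
  rcases h with rfl | rfl
  · exact ⟨a + 2, by fin_cases a <;> decide, by fin_cases a <;> decide, Or.inl (I_mul_succ a)⟩
  · exact ⟨b + 2, by fin_cases b <;> decide, by fin_cases b <;> decide, Or.inr (I_succ_mul b)⟩

theorem trace_one_idx : (1 : Matrix (Idx n) (Idx n) ℝ).trace = 4 * n := by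
  simp [Matrix.trace_one, mul_comm]

end Units

/-- A multiple of the projection of `gl(4n)` whose restriction to `so(4n)` is the projection to
`(sp(n) + sp(1))^⊥`. -/
def obsPart (n : ℕ) : Matrix (Idx n) (Idx n) ℝ →ₗ[ℝ] Matrix (Idx n) (Idx n) ℝ where
  -- The sum ∑ I_a A I_a is -3A if A commutes with I, J, K, which fixes the ratio of the first two
  -- coefficients. It is A for A = I_b, where the trace term -4n I_b cancels the remaining 3n + n.
  -- On (sp(n) + sp(1))^⊥ the map is multiplication by 4n.
  toFun A := (3 * n : ℝ) • A + (n : ℝ) • ∑ a, I n a * A * I n a + ∑ a, (A * I n a).trace • I n a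
  map_add' A B := by
    simp only [mul_add, add_mul, Finset.sum_add_distrib, Matrix.trace_add, add_smul, smul_add]
    abel
  map_smul' c A := by
    simp only [mul_smul_comm, smul_mul_assoc, Matrix.trace_smul, smul_eq_mul, smul_add,
      Finset.smul_sum, smul_smul, RingHom.id_apply, mul_comm]

theorem obsPart_apply (A : Matrix (Idx n) (Idx n) ℝ) : obsPart n A =
    (3 * n : ℝ) • A + (n : ℝ) • ∑ a, I n a * A * I n a + ∑ a, (A * I n a).trace • I n a := rfl

/-- Conjugation by a unit that anticommutes with I_a sends A I_a to its negative, so the trace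
equals its own negative. -/
theorem trace_mul_I_of_commute {A : Matrix (Idx n) (Idx n) ℝ} (hA : ∀ a, A * I n a = I n a * A)
    (a : Fin 3) : (A * I n a).trace = 0 := by
  have hne : a + 1 ≠ a := by fin_cases a <;> decide
  have h1 : I n (a + 1) * (A * I n a * I n (a + 1)) = A * I n a := by
    rw [← mul_assoc, ← mul_assoc, ← hA, mul_assoc, mul_assoc A, ← mul_assoc (I n (a + 1)),
      I_mul_I_mul_self hne]
  have h2 := Matrix.trace_mul_comm (I n (a + 1)) (A * I n a * I n (a + 1))
  rw [h1, mul_assoc, I_mul_self, mul_neg, mul_one, Matrix.trace_neg] at h2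
  linarith

theorem obsPart_of_commute {A : Matrix (Idx n) (Idx n) ℝ} (hA : ∀ a, A * I n a = I n a * A) :
    obsPart n A = 0 := by
  have h1 : ∀ a, I n a * A * I n a = -A := fun a => by
    rw [← hA, mul_assoc, I_mul_self, mul_neg, mul_one]
  simp only [obsPart_apply, h1, trace_mul_I_of_commute hA, Fin.sum_univ_three]
  module

theorem trace_I_mul_I {a b : Fin 3} (hab : a ≠ b) : (I n a * I n b).trace = 0 := by
  obtain ⟨c, -, -, h | h⟩ := exists_I_mul_I (n := n) hab <;> simp [h, trace_I]

theorem obsPart_I (b : Fin 3) : obsPart n (I n b) = 0 := by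
  have h1 : I n (b + 1) * I n b * I n (b + 1) = I n b :=
    I_mul_I_mul_self (by fin_cases b <;> decide)
  have h2 : I n (b + 2) * I n b * I n (b + 2) = I n b :=
    I_mul_I_mul_self (by fin_cases b <;> decide)
  rw [obsPart_apply, sum_fin_three_cyclic _ b, sum_fin_three_cyclic _ b, h1, h2, I_mul_self,
    trace_I_mul_I (a := b) (b := b + 1) (by fin_cases b <;> decide),
    trace_I_mul_I (a := b) (b := b + 2) (by fin_cases b <;> decide), Matrix.trace_neg, trace_one_idx]
  simp only [neg_mul, one_mul]
  module

theorem obsPart_of_mem_sp_sup_sp1 {A : Matrix (Idx n) (Idx n) ℝ} (hA : A ∈ sp n ⊔ sp1 n) :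
    obsPart n A = 0 := by
  have h : sp n ⊔ sp1 n ≤ LinearMap.ker (obsPart n) := by
    refine sup_le (fun B hB => obsPart_of_commute hB.2) (Submodule.span_le.2 ?_)
    rintro _ ⟨b, rfl⟩
    exact obsPart_I b
  exact h hA

/-- The equivariant map `w ↦ ∑ₖ P(w(ε_k)) ε_k` to `ℍⁿ`, where `P` is `obsPart`. -/
def contraction (n : ℕ) : Tensor n →ₗ[ℝ] (Idx n → ℝ) where
  toFun w i := ∑ k, obsPart n (w k) i k
  map_add' v w := by
    ext i
    simp [Finset.sum_add_distrib]
  map_smul' c w := by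
    ext i
    simp [Finset.mul_sum]

theorem contraction_apply (w : Tensor n) (i : Idx n) :
    contraction n w i = ∑ k, obsPart n (w k) i k := rfl

section Equivariance

theorem exists_rotation {B : Matrix (Idx n) (Idx n) ℝ} (hB : B ∈ Sp1Group n) :
    ∃ R : Matrix (Fin 3) (Fin 3) ℝ, Rᵀ * R = 1 ∧ ∀ a, Bᵀ * I n a * B = ∑ b, R a b • I n b := by
  obtain ⟨c, d, hcd, rfl⟩ := hB
  rw [Fin.sum_univ_three] at hcd
  -- This is the classical rotation matrix of the unit quaternion c + ∑ dₐ Iₐ acting by conjugation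
  -- on imaginary quaternions.
  refine ⟨!![c ^ 2 + d 0 ^ 2 - d 1 ^ 2 - d 2 ^ 2, 2 * d 0 * d 1 - 2 * c * d 2, 2 * d 0 * d 2 + 2 * c * d 1;
    2 * d 0 * d 1 + 2 * c * d 2, c ^ 2 - d 0 ^ 2 + d 1 ^ 2 - d 2 ^ 2, 2 * d 1 * d 2 - 2 * c * d 0;
    2 * d 0 * d 2 - 2 * c * d 1, 2 * d 1 * d 2 + 2 * c * d 0, c ^ 2 - d 0 ^ 2 - d 1 ^ 2 + d 2 ^ 2], ?_, ?_⟩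
  · ext i j
    -- With N the squared norm, RᵀR = N² · 1, and N² - 1 = (N + 1)(N - 1) explains the multiplier of
    -- `hcd`.
    fin_cases i <;> fin_cases j <;> simp [Matrix.mul_apply, Fin.sum_univ_three] <;> first | ring1 | linear_combination (c ^ 2 + d 0 ^ 2 + d 1 ^ 2 + d 2 ^ 2 + 1) * hcd
  · have h01 : I n 0 * I n 1 = I n 2 := I_mul_succ 0
    have h12 : I n 1 * I n 2 = I n 0 := I_mul_succ 1
    have h20 : I n 2 * I n 0 = I n 1 := I_mul_succ 2
    have h10 : I n 1 * I n 0 = -I n 2 := I_succ_mul 0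
    have h21 : I n 2 * I n 1 = -I n 0 := I_succ_mul 1
    have h02 : I n 0 * I n 2 = -I n 1 := I_succ_mul 2
    intro a
    fin_cases a <;>
    · simp [Fin.sum_univ_three, I_transpose, mul_add, add_mul, h01, h12, h20, h10, h21, h02,
        I_mul_self, smul_smul]
      module

/-- Both sums in `obsPart` are of the form ∑ Φ(I_a, I_a). Their invariance under rotations of (I, J,
K) is what makes `obsPart` equivariant under Sp(1) and not only under Sp(n). -/
theorem sum_bilinear_rotation {V W : Type*} [AddCommGroup V] [Module ℝ V] [AddCommGroup W]
    [Module ℝ W] (Φ : V →ₗ[ℝ] V →ₗ[ℝ] W) {R : Matrix (Fin 3) (Fin 3) ℝ} (hR : Rᵀ * R = 1)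
    (x : Fin 3 → V) :
    ∑ a, Φ (∑ b, R a b • x b) (∑ b, R a b • x b) = ∑ b, Φ (x b) (x b) := by
  have h : ∀ b c, ∑ a, R a b * R a c = if b = c then 1 else 0 := fun b c => by
    have := congrFun (congrFun hR b) c
    simpa [Matrix.mul_apply, Matrix.one_apply] using this
  simp only [map_sum, LinearMap.sum_apply, map_smul, LinearMap.smul_apply, Finset.smul_sum,
    smul_smul]
  rw [Finset.sum_comm]
  refine Finset.sum_congr rfl fun c _ => ?_
  rw [Finset.sum_comm, Finset.sum_eq_single c]
  · rw [← Finset.sum_smul, h, if_pos rfl, one_smul]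
  · intro b _ hb
    rw [← Finset.sum_smul, h, if_neg (by tauto), zero_smul]
  · simp

theorem obsPart_conj {g X : Matrix (Idx n) (Idx n) ℝ} (hg : gᵀ * g = 1)
    {R : Matrix (Fin 3) (Fin 3) ℝ} (hR : Rᵀ * R = 1)
    (hgR : ∀ a, gᵀ * I n a * g = ∑ b, R a b • I n b) :
    obsPart n (g * X * gᵀ) = g * obsPart n X * gᵀ := by
  have hg' : g * gᵀ = 1 := mul_eq_one_comm.1 hg
  have hIg : ∀ a, I n a * g = g * (gᵀ * I n a * g) := fun a => by
    rw [← mul_assoc, ← mul_assoc, hg', one_mul]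
  have hgI : ∀ a, gᵀ * I n a = (gᵀ * I n a * g) * gᵀ := fun a => by
    rw [mul_assoc _ g, hg', mul_one]
  have h1 : ∀ a, I n a * (g * X * gᵀ) * I n a =
      g * ((gᵀ * I n a * g) * X * (gᵀ * I n a * g)) * gᵀ := fun a => by
    calc I n a * (g * X * gᵀ) * I n a = (I n a * g) * X * (gᵀ * I n a) := by
          simp only [mul_assoc]
      _ = (g * (gᵀ * I n a * g)) * X * ((gᵀ * I n a * g) * gᵀ) := by rw [← hIg, ← hgI]
      _ = _ := by simp only [mul_assoc]
  have h2 : ∀ a, (g * X * gᵀ * I n a).trace • I n a =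
      g * ((X * (gᵀ * I n a * g)).trace • (gᵀ * I n a * g)) * gᵀ := fun a => by
    have e1 : (g * X * gᵀ * I n a).trace = (X * (gᵀ * I n a * g)).trace := by
      rw [mul_assoc, mul_assoc, Matrix.trace_mul_comm, mul_assoc]
    have e2 : g * (gᵀ * I n a * g) * gᵀ = I n a := by
      rw [← hIg, mul_assoc, hg', mul_one]
    rw [e1, mul_smul_comm, smul_mul_assoc, e2]
  let Φ₁ : Matrix (Idx n) (Idx n) ℝ →ₗ[ℝ] Matrix (Idx n) (Idx n) ℝ →ₗ[ℝ] Matrix (Idx n) (Idx n) ℝ :=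
    LinearMap.mk₂ ℝ (fun Y Z => Y * X * Z) (fun _ _ _ => by simp only [add_mul])
      (fun _ _ _ => by simp only [smul_mul_assoc]) (fun _ _ _ => by simp only [mul_add])
      (fun _ _ _ => by simp only [mul_smul_comm])
  let Φ₂ : Matrix (Idx n) (Idx n) ℝ →ₗ[ℝ] Matrix (Idx n) (Idx n) ℝ →ₗ[ℝ] Matrix (Idx n) (Idx n) ℝ :=
    LinearMap.mk₂ ℝ (fun Y Z => (X * Y).trace • Z)
      (fun _ _ _ => by simp only [mul_add, Matrix.trace_add, add_smul])
      (fun _ _ _ => by simp only [mul_smul_comm, Matrix.trace_smul, smul_eq_mul, mul_smul])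
      (fun _ _ _ => by simp only [smul_add])
      (fun _ _ _ => smul_comm _ _ _)
  have h3 : ∑ a, (gᵀ * I n a * g) * X * (gᵀ * I n a * g) = ∑ a, I n a * X * I n a := by
    simp only [hgR]
    exact sum_bilinear_rotation Φ₁ hR (I n)
  have h4 : ∑ a, (X * (gᵀ * I n a * g)).trace • (gᵀ * I n a * g)
      = ∑ a, (X * I n a).trace • I n a := by
    simp only [hgR]
    exact sum_bilinear_rotation Φ₂ hR (I n)
  simp only [obsPart_apply, h1, h2, ← Finset.mul_sum, ← Finset.sum_mul, h3, h4]
  simp only [mul_add, add_mul, mul_smul_comm, smul_mul_assoc]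

theorem contraction_act {g : Matrix (Idx n) (Idx n) ℝ} (hg : gᵀ * g = 1)
    {R : Matrix (Fin 3) (Fin 3) ℝ} (hR : Rᵀ * R = 1)
    (hgR : ∀ a, gᵀ * I n a * g = ∑ b, R a b • I n b) (w : Tensor n) :
    contraction n (act g w) = g *ᵥ contraction n w := by
  ext i
  simp only [contraction_apply, act, map_sum, map_smul, obsPart_conj hg hR hgR]
  simp only [Matrix.sum_apply, Matrix.smul_apply, smul_eq_mul]
  rw [Finset.sum_comm]
  have h : ∀ l, ∑ k, g k l * (g * obsPart n (w l) * gᵀ) i k = (g * obsPart n (w l)) i l := by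
    intro l
    have e : g * obsPart n (w l) * gᵀ * g = g * obsPart n (w l) := by
      rw [mul_assoc, hg, mul_one]
    conv_rhs => rw [← e, Matrix.mul_apply]
    exact Finset.sum_congr rfl fun k _ => mul_comm _ _
  rw [Finset.sum_congr rfl fun l _ => h l]
  simp only [Matrix.mul_apply, Matrix.mulVec, dotProduct, contraction_apply, Finset.mul_sum]
  rw [Finset.sum_comm]

theorem isIntertwiner_contraction : IsIntertwiner (contraction n) := by
  rintro A ⟨hA, hAI⟩ B hB w
  obtain ⟨R, hR, hBR⟩ := exists_rotation hB
  have hAI' : ∀ a, Aᵀ * I n a * A = I n a := fun a => by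
    rw [mul_assoc, ← hAI, ← mul_assoc, hA, one_mul]
  have hBB : Bᵀ * B = 1 := by
    obtain ⟨c, d, hcd, rfl⟩ := hB
    have h01 : I n 0 * I n 1 = I n 2 := I_mul_succ 0
    have h12 : I n 1 * I n 2 = I n 0 := I_mul_succ 1
    have h20 : I n 2 * I n 0 = I n 1 := I_mul_succ 2
    have h10 : I n 1 * I n 0 = -I n 2 := I_succ_mul 0
    have h21 : I n 2 * I n 1 = -I n 0 := I_succ_mul 1
    have h02 : I n 0 * I n 2 = -I n 1 := I_succ_mul 2
    trans (c ^ 2 + ∑ a, d a ^ 2) • (1 : Matrix (Idx n) (Idx n) ℝ)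
    · simp only [Fin.sum_univ_three, Matrix.transpose_add, Matrix.transpose_smul,
        Matrix.transpose_one, I_transpose, mul_add, add_mul, h01, h12, h20, h10, h21, h02,
        I_mul_self, smul_mul_assoc, mul_smul_comm, neg_mul, one_mul, mul_one]
      module
    · rw [hcd, one_smul]
  refine contraction_act ?_ hR (fun a => ?_) w
  · rw [Matrix.transpose_mul, mul_assoc, ← mul_assoc Aᵀ, hA, one_mul, hBB]
  · rw [← hBR, Matrix.transpose_mul]
    calc Bᵀ * Aᵀ * I n a * (A * B) = Bᵀ * (Aᵀ * I n a * A) * B := by simp only [mul_assoc]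
      _ = _ := by rw [hAI']

end Equivariance

end QuatModel

namespace QuatModel

variable {n : ℕ}

/-! ### The contraction on elementary tensors -/

theorem contraction_of_commute {w : Tensor n} (hw : ∀ k a, w k * I n a = I n a * w k) :
    contraction n w = 0 := by
  ext i
  simp [contraction_apply, obsPart_of_commute (hw _)]

theorem contraction_smul_const (α : Idx n → ℝ) (M : Matrix (Idx n) (Idx n) ℝ) :
    contraction n (fun k => α k • M) = obsPart n M *ᵥ α := by
  ext i
  simp [contraction_apply, Matrix.mulVec, dotProduct, mul_comm]

theorem contraction_apply_expand (w : Tensor n) (i : Idx n) :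
    contraction n w i = (3 * n : ℝ) * ∑ k, w k i k + (n : ℝ) * ∑ a, ∑ k, (I n a * w k * I n a) i k
      + ∑ a, ∑ k, (w k * I n a).trace * I n a i k := by
  have e1 := Finset.sum_comm (s := Finset.univ) (t := Finset.univ)
    (f := fun k a => (I n a * w k * I n a) i k)
  have e2 := Finset.sum_comm (s := Finset.univ) (t := Finset.univ)
    (f := fun k a => (w k * I n a).trace * I n a i k)
  rw [← e1, ← e2]
  simp only [contraction_apply, obsPart_apply, Matrix.add_apply, Matrix.smul_apply,
    Matrix.sum_apply, smul_eq_mul, Finset.sum_add_distrib, ← Finset.mul_sum]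

/-- The difference tensor is a sum of three kinds of elementary tensors: X ↦ (MX) vᵀ, X ↦ v (MX)ᵀ
and X ↦ α(X) M. This lemma, `contraction_vecMulVec_col_right` and `contraction_smul_const` treat one
kind each. -/
theorem contraction_vecMulVec_col_left (M : Matrix (Idx n) (Idx n) ℝ) (v : Idx n → ℝ) :
    contraction n (fun k => Matrix.vecMulVec (M.col k) v) =
      (3 * n : ℝ) • M *ᵥ v - (n : ℝ) • ∑ a, (I n a * M * I n a) *ᵥ v
        - ∑ a, (I n a * Mᵀ * I n a) *ᵥ v := by
  ext i
  have h0 : ∑ k, Matrix.vecMulVec (M.col k) v i k = (M *ᵥ v) i := by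
    simp [Matrix.vecMulVec_apply, Matrix.mulVec, dotProduct]
  have h1 : ∀ a, ∑ k, (I n a * Matrix.vecMulVec (M.col k) v * I n a) i k
      = -((I n a * M * I n a) *ᵥ v) i := by
    intro a
    have e : -(I n a * M * I n a) *ᵥ v = (I n a * M) *ᵥ (v ᵥ* I n a) := by
      rw [← Matrix.mulVec_transpose, I_transpose, Matrix.mulVec_mulVec, mul_neg]
    rw [← Pi.neg_apply, ← Matrix.neg_mulVec, e]
    simp only [Matrix.mul_vecMulVec, Matrix.vecMulVec_mul, Matrix.vecMulVec_apply]
    rfl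
  have h2 : ∀ a, ∑ k, (Matrix.vecMulVec (M.col k) v * I n a).trace * I n a i k
      = -((I n a * Mᵀ * I n a) *ᵥ v) i := by
    intro a
    have e : -(I n a * Mᵀ * I n a) *ᵥ v = I n a *ᵥ ((v ᵥ* I n a) ᵥ* M) := by
      rw [← Matrix.mulVec_transpose, ← Matrix.mulVec_transpose, I_transpose, Matrix.mulVec_mulVec,
        Matrix.mulVec_mulVec, mul_neg, mul_assoc]
    rw [← Pi.neg_apply, ← Matrix.neg_mulVec, e]
    simp only [Matrix.vecMulVec_mul, Matrix.trace_vecMulVec]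
    refine Finset.sum_congr rfl fun k _ => ?_
    rw [mul_comm, dotProduct_comm]
    rfl
  rw [contraction_apply_expand, h0]
  simp only [h1, h2, Finset.sum_neg_distrib, Pi.sub_apply, Pi.smul_apply, Finset.sum_apply,
    smul_eq_mul, mul_neg, sub_eq_add_neg,
    Pi.add_apply, Pi.neg_apply]

theorem contraction_vecMulVec_col_right (M : Matrix (Idx n) (Idx n) ℝ) (v : Idx n → ℝ) :
    contraction n (fun k => Matrix.vecMulVec v (M.col k)) =
      (3 * n * M.trace : ℝ) • v + (n : ℝ) • ∑ a, (Mᵀ * I n a).trace • I n a *ᵥ v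
        + ∑ a, (I n a * Mᵀ * I n a) *ᵥ v := by
  ext i
  have h0 : ∑ k, Matrix.vecMulVec v (M.col k) i k = M.trace * v i := by
    simp [Matrix.vecMulVec_apply, Matrix.trace, Finset.mul_sum, mul_comm]
  have h1 : ∀ a, ∑ k, (I n a * Matrix.vecMulVec v (M.col k) * I n a) i k
      = (Mᵀ * I n a).trace * (I n a *ᵥ v) i := by
    intro a
    simp only [Matrix.mul_vecMulVec, Matrix.vecMulVec_mul, Matrix.vecMulVec_apply, Matrix.trace,
      Finset.sum_mul, Matrix.diag_apply]
    refine Finset.sum_congr rfl fun k _ => ?_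
    rw [mul_comm]
    rfl
  have h2 : ∀ a, ∑ k, (Matrix.vecMulVec v (M.col k) * I n a).trace * I n a i k
      = ((I n a * Mᵀ * I n a) *ᵥ v) i := by
    intro a
    have e : (I n a * Mᵀ * I n a) *ᵥ v = I n a *ᵥ (Mᵀ *ᵥ (I n a *ᵥ v)) := by
      rw [Matrix.mulVec_mulVec, Matrix.mulVec_mulVec, mul_assoc]
    rw [e]
    simp only [Matrix.trace_mul_comm _ (I n a), Matrix.mul_vecMulVec, Matrix.trace_vecMulVec]
    refine Finset.sum_congr rfl fun k _ => ?_
    rw [mul_comm, dotProduct_comm]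
    rfl
  rw [contraction_apply_expand, h0]
  simp only [h1, h2, Pi.add_apply, Pi.smul_apply, Finset.sum_apply, smul_eq_mul]
  ring

section LeviMatrices

variable {a : Fin 3} {G : Matrix (Idx n) (Idx n) ℝ}

theorem trace_of_levi_identity (hG : ∀ b, a ≠ b → G - I n b * G * I n b = (2 : ℝ) • 1) :
    G.trace = 4 * n := by
  have h := congrArg Matrix.trace (hG (a + 1) (by fin_cases a <;> decide))
  rw [Matrix.trace_sub, Matrix.trace_mul_comm, ← mul_assoc, I_mul_self, neg_mul, one_mul,
    Matrix.trace_neg, Matrix.trace_smul, trace_one_idx, smul_eq_mul] at h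
  linarith

theorem trace_mul_I_of_levi_identity (hG : ∀ b, a ≠ b → G - I n b * G * I n b = (2 : ℝ) • 1)
    {c : Fin 3} (hc : a ≠ c) : (G * I n c).trace = 0 := by
  have h := congrArg (fun A => (A * I n c).trace) (hG c hc)
  simp only [sub_mul, Matrix.trace_sub, mul_assoc, I_mul_self, mul_neg, mul_one, Matrix.trace_neg,
    smul_mul_assoc, one_mul, Matrix.trace_smul, trace_I, Matrix.trace_mul_comm (I n c) G,
    smul_zero] at h
  linarith

/-- The term b = a collapses because G commutes with I_a. For b ≠ a, the relation I_a I_b I_a = I_b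
reduces the term to the conjugate I_b G I_b, which the Levi identity evaluates. -/
theorem sum_conj_of_levi_identity (hGc : G * I n a = I n a * G)
    (hG : ∀ b, a ≠ b → G - I n b * G * I n b = (2 : ℝ) • 1) :
    ∑ b, I n b * (G * I n a) * I n b * I n a = (3 : ℝ) • G - (4 : ℝ) • 1 := by
  have h0 : I n a * (G * I n a) * I n a * I n a = G := by
    rw [mul_assoc _ (I n a) (I n a), I_mul_self, hGc, ← mul_assoc, I_mul_self]
    simp
  have h1 : ∀ b, a ≠ b → I n b * (G * I n a) * I n b * I n a = G - (2 : ℝ) • 1 := fun b hb => by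
    have e : I n b * (G * I n a) * I n b * I n a = I n b * G * (I n a * I n b * I n a) := by
      simp only [mul_assoc]
    rw [e, I_mul_I_mul_self hb, ← hG b hb]
    abel
  rw [sum_fin_three_cyclic _ a, h0, h1 _ (by fin_cases a <;> decide),
    h1 _ (by fin_cases a <;> decide)]
  module

theorem sum_trace_of_levi_identity (hG : ∀ b, a ≠ b → G - I n b * G * I n b = (2 : ℝ) • 1) :
    ∑ b, (G * I n a * I n b).trace • (I n b * I n a) = (4 * n : ℝ) • 1 := by
  have h1 : ∀ b, a ≠ b → (G * I n a * I n b).trace = 0 := fun b hb => by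
    obtain ⟨c, hca, -, h | h⟩ := exists_I_mul_I (n := n) hb
    · rw [mul_assoc, h, trace_mul_I_of_levi_identity hG hca.symm]
    · rw [mul_assoc, h, mul_neg, Matrix.trace_neg, trace_mul_I_of_levi_identity hG hca.symm,
        neg_zero]
  have h0 : (G * I n a * I n a).trace = -(4 * n) := by
    rw [mul_assoc, I_mul_self, mul_neg, mul_one, Matrix.trace_neg, trace_of_levi_identity hG]
  rw [sum_fin_three_cyclic _ a, h1 (a + 1) (by fin_cases a <;> decide),
    h1 (a + 2) (by fin_cases a <;> decide), h0, I_mul_self]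
  module

/-- The argument is the contribution of dθ_a and I_a W to the Koszul formula, since G I_a = -dθ_a as
a matrix. Summed over a, the scalar becomes 3(8 - 4n(n+1)) = -6(n-1)(2n+4), so n - 1 factors out of
the whole contraction and the coefficient 2n+4 of h appears. -/
theorem contraction_levi_term (hGs : Gᵀ = G) (hGc : G * I n a = I n a * G)
    (hG : ∀ b, a ≠ b → G - I n b * G * I n b = (2 : ℝ) • 1) (W : Idx n → ℝ) :
    contraction n (fun k => Matrix.vecMulVec (I n a *ᵥ W) ((G * I n a).col k)
          - Matrix.vecMulVec ((G * I n a).col k) (I n a *ᵥ W)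
          - (I n a *ᵥ W) k • (G * I n a))
      = (6 * (n - 1) : ℝ) • G *ᵥ W + (8 - 4 * n * (n + 1) : ℝ) • W := by
  have hm : (G * I n a)ᵀ = -(G * I n a) := by
    rw [Matrix.transpose_mul, I_transpose, hGs, neg_mul, hGc]
  have htr : (G * I n a).trace = 0 := by
    have h := Matrix.trace_transpose (G * I n a)
    rw [hm, Matrix.trace_neg] at h
    linarith
  have e1 : (G * I n a) *ᵥ (I n a *ᵥ W) = -(G *ᵥ W) := by
    rw [Matrix.mulVec_mulVec, mul_assoc, I_mul_self, mul_neg, mul_one, Matrix.neg_mulVec]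
  have e2 : ∑ b, (I n b * (G * I n a) * I n b) *ᵥ (I n a *ᵥ W) = (3 : ℝ) • G *ᵥ W - (4 : ℝ) • W := by
    simp only [Matrix.mulVec_mulVec]
    rw [← Matrix.sum_mulVec, sum_conj_of_levi_identity hGc hG, Matrix.sub_mulVec,
      Matrix.smul_mulVec, Matrix.smul_mulVec, Matrix.one_mulVec]
  have e3 : ∑ b, (G * I n a * I n b).trace • I n b *ᵥ (I n a *ᵥ W) = (4 * n : ℝ) • W := by
    simp only [Matrix.mulVec_mulVec, ← Matrix.smul_mulVec]
    rw [← Matrix.sum_mulVec, sum_trace_of_levi_identity hG, Matrix.smul_mulVec, Matrix.one_mulVec]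
  have hsplit : (fun k => Matrix.vecMulVec (I n a *ᵥ W) ((G * I n a).col k)
          - Matrix.vecMulVec ((G * I n a).col k) (I n a *ᵥ W)
          - (I n a *ᵥ W) k • (G * I n a)) =
      (fun k => Matrix.vecMulVec (I n a *ᵥ W) ((G * I n a).col k))
        - (fun k => Matrix.vecMulVec ((G * I n a).col k) (I n a *ᵥ W))
        - (fun k => (I n a *ᵥ W) k • (G * I n a)) := rfl
  have e4 : obsPart n (G * I n a) *ᵥ (I n a *ᵥ W)
      = (3 * n : ℝ) • (-(G *ᵥ W)) + (n : ℝ) • ((3 : ℝ) • G *ᵥ W - (4 : ℝ) • W) + (4 * n : ℝ) • W := by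
    rw [← e1, ← e2, ← e3, obsPart_apply]
    simp only [Matrix.add_mulVec, Matrix.smul_mulVec, Matrix.sum_mulVec]
  rw [hsplit, map_sub, map_sub, contraction_vecMulVec_col_right, contraction_vecMulVec_col_left,
    contraction_smul_const, e4, hm, htr]
  simp only [mul_neg, neg_mul, Matrix.neg_mulVec, Finset.sum_neg_distrib, Matrix.trace_neg,
    neg_smul, e1, e2, e3]
  module

end LeviMatrices

theorem contraction_conformal_term (α : Idx n → ℝ) :
    contraction n (fun k => α k • 1 + Matrix.vecMulVec ((1 : Matrix (Idx n) (Idx n) ℝ).col k) α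
        - Matrix.vecMulVec α ((1 : Matrix (Idx n) (Idx n) ℝ).col k))
      = -(6 * (n - 1) * (2 * n + 1) : ℝ) • α := by
  have hsplit : (fun k => α k • 1 + Matrix.vecMulVec ((1 : Matrix (Idx n) (Idx n) ℝ).col k) α
        - Matrix.vecMulVec α ((1 : Matrix (Idx n) (Idx n) ℝ).col k)) =
      (fun k => α k • 1) + (fun k => Matrix.vecMulVec ((1 : Matrix (Idx n) (Idx n) ℝ).col k) α)
        - (fun k => Matrix.vecMulVec α ((1 : Matrix (Idx n) (Idx n) ℝ).col k)) := rfl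
  rw [hsplit, map_sub, map_add, contraction_vecMulVec_col_right, contraction_vecMulVec_col_left,
    contraction_smul_const, obsPart_of_commute (fun a => by rw [one_mul, mul_one])]
  simp only [Matrix.transpose_one, mul_one, one_mul, I_mul_self, trace_I, trace_one_idx, zero_smul,
    Matrix.zero_mulVec, Matrix.one_mulVec, Matrix.neg_mulVec, Fin.sum_univ_three]
  module

/-- The contraction of the difference tensor of the two connections, in matrix form. -/
theorem contraction_difference (G : Fin 3 → Matrix (Idx n) (Idx n) ℝ)
    (hGs : ∀ a, (G a)ᵀ = G a) (hGc : ∀ a, G a * I n a = I n a * G a)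
    (hG : ∀ a b, a ≠ b → G a - I n b * G a * I n b = (2 : ℝ) • 1) (α W : Idx n → ℝ) :
    contraction n (fun k => α k • 1 + Matrix.vecMulVec ((1 : Matrix (Idx n) (Idx n) ℝ).col k) α
        - Matrix.vecMulVec α ((1 : Matrix (Idx n) (Idx n) ℝ).col k)
        + ∑ a, (Matrix.vecMulVec (I n a *ᵥ W) ((G a * I n a).col k)
          - Matrix.vecMulVec ((G a * I n a).col k) (I n a *ᵥ W)
          - (I n a *ᵥ W) k • (G a * I n a)))
      = (6 * (n - 1) : ℝ) • ((∑ a, G a *ᵥ W) - (2 * n + 4 : ℝ) • W - (2 * n + 1 : ℝ) • α) := by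
  have hsplit : ∀ (u : Tensor n) (v : Fin 3 → Tensor n),
      (fun k => u k + ∑ a, v a k) = u + ∑ a, v a := fun u v => by
    ext1 k
    simp
  rw [hsplit (fun k => _) (fun a k => _), map_add, map_sum, contraction_conformal_term]
  simp only [contraction_levi_term (hGs _) (hGc _) (hG _), Fin.sum_univ_three]
  module

end QuatModel

/-! ### The algebraic consequence of integrability -/

namespace QuatModel

variable {n : ℕ}

theorem fin_three_cases (a b : Fin 3) : b = a ∨ b = a + 1 ∨ b = a + 2 := by
  revert a b; decide

/-- Here I_c = ±I_a I_b. The factors I_b can be moved through G and absorbed, and the sign occurs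
twice. -/
theorem I_conj_eq_of_commute {a b c : Fin 3} (hab : a ≠ b) (hcb : c ≠ b) (hac : a ≠ c)
    {G : Matrix (Idx n) (Idx n) ℝ} (hG : G * I n b = I n b * G) :
    I n c * G * I n c = I n a * G * I n a := by
  obtain ⟨c', hc'a, hc'b, h⟩ := exists_I_mul_I (n := n) hab
  have hc : c' = c := by clear h hG; revert a b c c'; decide
  subst hc
  have e : I n a * I n b * G * (I n a * I n b) = I n a * G * I n a := by
    calc I n a * I n b * G * (I n a * I n b) = I n a * (I n b * G) * (I n a * I n b) := by
          simp only [mul_assoc]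
      _ = I n a * G * (I n b * I n a * I n b) := by rw [← hG]; simp only [mul_assoc]
      _ = _ := by rw [I_mul_I_mul_self hab.symm]
  rcases h with h | h
  · rw [← e, h]
  · rw [← e, h]
    simp

/-- The consequence of integrability for the Levi matrices `G_a = Θ_a I_a`, where `Θ_a` is the
matrix of `dθ_a` on `Q` in an adapted frame. -/
theorem levi_identity {Θ : Fin 3 → Matrix (Idx n) (Idx n) ℝ}
    (hc : ∀ a, Θ a * I n a = I n a * Θ a)
    (hJ : ∀ a, Θ (a + 1) + I n a * Θ (a + 1) * I n a
      = Θ (a + 2) * I n a - I n a * Θ (a + 2))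
    (hL : Θ 0 * I n 0 - I n 1 * Θ 0 * I n 2 = (2 : ℝ) • 1) (a b : Fin 3) (hab : a ≠ b) :
    Θ a * I n a - I n b * (Θ a * I n a) * I n b = (2 : ℝ) • 1 := by
  have hGc : ∀ a, Θ a * I n a * I n a = I n a * (Θ a * I n a) := fun a => by
    rw [hc, mul_assoc, hc, ← mul_assoc]
  -- The second integrability condition, multiplied on the right by I_{a+1}, says that G_{a+1} and
  -- G_{a+2} have the same value of G - I_a G I_a. This transports the normalization of G_0 to G_1
  -- and G_2.
  have hK : ∀ a, Θ (a + 1) * I n (a + 1) - I n a * (Θ (a + 1) * I n (a + 1)) * I n a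
      = Θ (a + 2) * I n (a + 2) - I n a * (Θ (a + 2) * I n (a + 2)) * I n a := fun a => by
    have h := congrArg (fun A => A * I n (a + 1)) (hJ a)
    have h1 : I n (a + 2) * I n a = I n (a + 1) := by
      have := I_mul_succ (n := n) (a + 2)
      rwa [show a + 2 + 1 = a by fin_cases a <;> decide,
        show a + 2 + 2 = a + 1 by fin_cases a <;> decide] at this
    simp only [add_mul, sub_mul, mul_assoc] at h ⊢
    rw [I_mul_succ] at h
    rw [h1, ← h, I_succ_mul, ← I_mul_succ]
    simp only [mul_neg, sub_neg_eq_add, I_mul_succ]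
  -- Since I_2 = I_0 I_1, the normalization of the Levi form is the wanted identity for a = 0, b =
  -- 1.
  have h01 : Θ 0 * I n 0 - I n 1 * (Θ 0 * I n 0) * I n 1 = (2 : ℝ) • 1 := by
    rw [← hL, show I n 2 = I n 0 * I n 1 from (I_mul_succ 0).symm]
    simp only [mul_assoc]
  have hany : ∀ a b c, a ≠ b → a ≠ c →
      Θ a * I n a - I n b * (Θ a * I n a) * I n b = (2 : ℝ) • 1 →
      Θ a * I n a - I n c * (Θ a * I n a) * I n c = (2 : ℝ) • 1 := fun a b c hab hac h => by
    by_cases hbc : b = c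
    · rwa [← hbc]
    · rwa [I_conj_eq_of_commute hab.symm hac.symm hbc (hGc a)]
  have h02 := hany 0 1 2 (by decide) (by decide) h01
  have h12 : Θ 1 * I n 1 - I n 2 * (Θ 1 * I n 1) * I n 2 = (2 : ℝ) • 1 := (hK 2).symm.trans h02
  have h21 : Θ 2 * I n 2 - I n 1 * (Θ 2 * I n 2) * I n 1 = (2 : ℝ) • 1 := (hK 1).trans h01
  fin_cases a
  · exact hany 0 1 b (by decide) hab h01
  · exact hany 1 2 b (by decide) hab h12
  · exact hany 2 1 b (by decide) hab h21

end QuatModel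

/-! ### Pointwise bilinear forms and the quaternion relations on Q -/

section Bilinear

variable {n : ℕ} {M : Type*} [TopologicalSpace M]
  [ChartedSpace (EuclideanSpace ℝ (Fin (4 * n + 3))) M]

theorem OneForm.d_swap (η : OneForm n M) (x : M) (u v : TangentSpace (𝓡 (4 * n + 3)) x) :
    η.d x u v = -η.d x v u := by
  have h := fun (F : EuclideanSpace ℝ (Fin (4 * n + 3)) [⋀^Fin 2]→L[ℝ] ℝ)
      (w₁ w₂ : EuclideanSpace ℝ (Fin (4 * n + 3))) => F.map_swap ![w₁, w₂] zero_ne_one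
  have e : ∀ w₁ w₂ : EuclideanSpace ℝ (Fin (4 * n + 3)),
      ![w₁, w₂] ∘ Equiv.swap (0 : Fin 2) 1 = ![w₂, w₁] := fun w₁ w₂ => by
    ext1 i; fin_cases i <;> simp
  simp only [e] at h
  exact h _ _ _

theorem OneForm.d_add_left (η : OneForm n M) (x : M) (u v w : TangentSpace (𝓡 (4 * n + 3)) x) :
    η.d x (u + v) w = η.d x u w + η.d x v w := by
  have h : ∀ (F : EuclideanSpace ℝ (Fin (4 * n + 3)) [⋀^Fin 2]→L[ℝ] ℝ)
      (A : TangentSpace (𝓡 (4 * n + 3)) x →L[ℝ] EuclideanSpace ℝ (Fin (4 * n + 3))),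
      F ![A (u + v), A w] = F ![A u, A w] + F ![A v, A w] := fun F A => by
    rw [map_add]
    exact F.toAlternatingMap.map_vecCons_add ![A w] _ _
  exact h _ _

theorem OneForm.d_smul_left (η : OneForm n M) (x : M) (c : ℝ)
    (u v : TangentSpace (𝓡 (4 * n + 3)) x) : η.d x (c • u) v = c • η.d x u v := by
  have h : ∀ (F : EuclideanSpace ℝ (Fin (4 * n + 3)) [⋀^Fin 2]→L[ℝ] ℝ)
      (A : TangentSpace (𝓡 (4 * n + 3)) x →L[ℝ] EuclideanSpace ℝ (Fin (4 * n + 3))),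
      F ![A (c • u), A v] = c • F ![A u, A v] := fun F A => by
    rw [map_smul]
    exact F.toAlternatingMap.map_vecCons_smul ![A v] _ _
  exact h _ _

/-- The exterior derivative of a one-form at a point, as a bilinear form. -/
noncomputable def OneForm.dBilin (η : OneForm n M) (x : M) :
    TangentSpace (𝓡 (4 * n + 3)) x →ₗ[ℝ] TangentSpace (𝓡 (4 * n + 3)) x →ₗ[ℝ] ℝ :=
  LinearMap.mk₂ ℝ (η.d x) (η.d_add_left x) (η.d_smul_left x)
    (fun u v w => by rw [η.d_swap, η.d_add_left, η.d_swap x u v, η.d_swap x u w, neg_add])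
    (fun c u v => by rw [η.d_swap, η.d_smul_left, η.d_swap x u v, smul_neg])

theorem OneForm.dBilin_apply (η : OneForm n M) (x : M) (u v : TangentSpace (𝓡 (4 * n + 3)) x) :
    η.dBilin x u v = η.d x u v := rfl

end Bilinear

namespace HyperCRStructure

variable {n : ℕ} {M : Type*} [TopologicalSpace M]
  [ChartedSpace (EuclideanSpace ℝ (Fin (4 * n + 3))) M] [IsManifold (𝓡 (4 * n + 3)) ∞ M]
  {S : HyperCRStructure n M} {θ : Fin 3 → OneForm n M}

theorem mem_Q_iff {x : M} {v : TangentSpace (𝓡 (4 * n + 3)) x} :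
    v ∈ S.Q x ↔ ∀ a, v ∈ (S.cr a).Q x := by
  simp [AlmostHyperCRStructure.Q]

namespace IsCompatible

theorem mem_Q_iff (hθ : S.IsCompatible θ) {x : M} {v : TangentSpace (𝓡 (4 * n + 3)) x} :
    v ∈ S.Q x ↔ ∀ a, θ a x v = 0 := by
  rw [HyperCRStructure.mem_Q_iff]
  exact forall_congr' fun a => (hθ.ker_eq a x v).symm

/-- The form θ_a vanishes on I_a v because I_a preserves Q_a. The other two vanish by applying θ_c ∘
I_a = θ_b to v and to I_a v. -/
theorem I_mem_Q (hθ : S.IsCompatible θ) {x : M} {v : TangentSpace (𝓡 (4 * n + 3)) x} (hv : v ∈ S.Q x) (a : Fin 3) :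
    S.I a x v ∈ S.Q x := by
  have hva := HyperCRStructure.mem_Q_iff.1 hv a
  have hIva := (S.cr a).J_mem x v hva
  rw [hθ.mem_Q_iff] at hv ⊢
  have h0 : θ a x (S.I a x v) = 0 := (hθ.ker_eq a x _).2 hIva
  have h2 : θ (a + 2) x (S.I a x v) = 0 := by rw [hθ.comp_eq a x v hva, hv]
  have h1 : θ (a + 1) x (S.I a x v) = 0 := by
    rw [← hθ.comp_eq a x _ hIva, (S.cr a).J_sq x v hva, map_neg, hv, neg_zero]
  intro b
  rcases QuatModel.fin_three_cases a b with rfl | rfl | rfl <;> assumption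

theorem I_I (S : HyperCRStructure n M) {x : M} {v : TangentSpace (𝓡 (4 * n + 3)) x}
    (hv : v ∈ S.Q x) (a : Fin 3) : S.I a x (S.I a x v) = -v :=
  (S.cr a).J_sq x v (HyperCRStructure.mem_Q_iff.1 hv a)

theorem mem_map_I (hθ : S.IsCompatible θ) {x : M} {v : TangentSpace (𝓡 (4 * n + 3)) x}
    (hv : v ∈ S.Q x) (a : Fin 3) :
    v ∈ ((S.cr 0).Q x ⊓ (S.cr 1).Q x).map (S.I a x) := by
  have h := HyperCRStructure.mem_Q_iff.1 (hθ.I_mem_Q hv a)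
  refine ⟨-S.I a x v, ⟨neg_mem (h 0), neg_mem (h 1)⟩, ?_⟩
  rw [map_neg, I_I S hv, neg_neg]

/-- The quaternion relations on `Q`. -/
theorem quaternion (hθ : S.IsCompatible θ) {x : M} {v : TangentSpace (𝓡 (4 * n + 3)) x}
    (hv : v ∈ S.Q x) (a : Fin 3) : S.I a x (S.I (a + 1) x v) = S.I (a + 2) x v ∧
      S.I (a + 1) x (S.I a x v) = -S.I (a + 2) x v := by
  -- Q lies in both I(Q₁ ∩ Q₂) and J(Q₁ ∩ Q₂), so both prescriptions for K hold on Q. Together they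
  -- give the anticommutation of I and J there.
  have h01 : ∀ v ∈ S.Q x, S.I 0 x (S.I 1 x v) = S.I 2 x v := fun v hv =>
    (S.third_J_right x v (hθ.mem_map_I hv 1)).symm
  have h10 : ∀ v ∈ S.Q x, S.I 1 x (S.I 0 x v) = -S.I 2 x v := fun v hv => by
    rw [show S.I 2 x v = -S.I 1 x (S.I 0 x v) from S.third_J_left x v (hθ.mem_map_I hv 0), neg_neg]
  have hI := hθ.I_mem_Q hv
  fin_cases a
  · exact ⟨h01 v hv, h10 v hv⟩
  · refine ⟨show S.I 1 x (S.I 2 x v) = S.I 0 x v from ?_,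
      show S.I 2 x (S.I 1 x v) = -S.I 0 x v from ?_⟩
    · rw [← neg_eq_iff_eq_neg.2 (h10 v hv), map_neg, I_I S (hI 0), neg_neg]
    · rw [← h01 _ (hI 1), I_I S hv, map_neg]
  · refine ⟨show S.I 2 x (S.I 0 x v) = S.I 1 x v from ?_,
      show S.I 0 x (S.I 2 x v) = -S.I 1 x v from ?_⟩
    · rw [← neg_eq_iff_eq_neg.2 (h10 _ (hI 0)), I_I S hv, map_neg, neg_neg]
    · rw [← h01 v hv, I_I S (hI 1)]

end IsCompatible

/-- `Levi_θ` at a point, as a bilinear form. -/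
noncomputable def leviBilin (S : HyperCRStructure n M) (θ : Fin 3 → OneForm n M) (x : M) :
    TangentSpace (𝓡 (4 * n + 3)) x →ₗ[ℝ] TangentSpace (𝓡 (4 * n + 3)) x →ₗ[ℝ] ℝ :=
  (1 / 2 : ℝ) • (((θ 0).dBilin x).compl₂ (S.I 0 x)
    + ((θ 0).dBilin x).compl₁₂ (S.I 1 x) (S.I 2 x))

theorem leviBilin_apply (S : HyperCRStructure n M) (θ : Fin 3 → OneForm n M) (x : M)
    (u v : TangentSpace (𝓡 (4 * n + 3)) x) : S.leviBilin θ x u v = S.levi θ x u v := rfl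

/-- The form `h` at a point, as a bilinear form. -/
noncomputable def hBilin (S : HyperCRStructure n M) (θ : Fin 3 → OneForm n M) (x : M) :
    TangentSpace (𝓡 (4 * n + 3)) x →ₗ[ℝ] TangentSpace (𝓡 (4 * n + 3)) x →ₗ[ℝ] ℝ :=
  (2 * n + 4 : ℝ) • S.leviBilin θ x - ∑ a, ((θ a).dBilin x).compl₂ (S.I a x)

theorem hBilin_apply (S : HyperCRStructure n M) (θ : Fin 3 → OneForm n M) (x : M)
    (u v : TangentSpace (𝓡 (4 * n + 3)) x) : S.hBilin θ x u v = S.h θ x u v := by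
  simp [hBilin, h, leviBilin_apply, OneForm.dBilin_apply, LinearMap.sum_apply]

end HyperCRStructure

/-! ### The integrability conditions in an adapted frame -/

namespace HyperCRStructure

variable {n : ℕ} {M : Type*} [TopologicalSpace M]
  [ChartedSpace (EuclideanSpace ℝ (Fin (4 * n + 3))) M] [IsManifold (𝓡 (4 * n + 3)) ∞ M]
  {S : HyperCRStructure n M} {θ : Fin 3 → OneForm n M}

namespace IsCompatible

theorem isSectionOn_I (hθ : S.IsCompatible θ) {U : Set M} (hU : IsOpen U) {X : VField n M}
    (hX : IsSectionOn S.Q X U) (a : Fin 3) : IsSectionOn S.Q (fun y => S.I a y (X y)) U :=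
  ⟨(S.cr a).J_smooth U X hU ⟨hX.1, fun x hx => HyperCRStructure.mem_Q_iff.1 (hX.2 x hx) a⟩,
    fun x hx => hθ.I_mem_Q (hX.2 x hx) a⟩

theorem d_apply_section (hθ : S.IsCompatible θ) {U : Set M} (hU : IsOpen U) {X Y : VField n M}
    (hX : IsSectionOn S.Q X U) (hY : IsSectionOn S.Q Y U) {x : M} (hx : x ∈ U) (a : Fin 3) :
    (θ a).d x (X x) (Y x) = -θ a x (mlieBracket (𝓡 (4 * n + 3)) X Y x) :=
  OneForm.SmoothOn.d_apply_of_ker (U := U) (fun y _ => ((hθ.smooth a) y trivial).mono (subset_univ _))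
    hU hx hX.1 hY.1 (fun y hy => hθ.mem_Q_iff.1 (hX.2 y hy) a)
    (fun y hy => hθ.mem_Q_iff.1 (hY.2 y hy) a)

theorem d_I_I (hθ : S.IsCompatible θ) {U : Set M} (hU : IsOpen U) {X Y : VField n M}
    (hX : IsSectionOn S.Q X U) (hY : IsSectionOn S.Q Y U) {x : M} (hx : x ∈ U) (a : Fin 3) :
    (θ a).d x (S.I a x (X x)) (S.I a x (Y x)) = (θ a).d x (X x) (Y x) := by
  have h := (hθ.ker_eq a x _).2 (S.integrable_mem a U X Y hU hX hY x hx)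
  have e := hθ.d_apply_section hU (hθ.isSectionOn_I hU hX a) (hθ.isSectionOn_I hU hY a) hx a
  rw [e, hθ.d_apply_section hU hX hY hx]
  rw [map_sub] at h
  linarith

/-- Apply θ_{a+2} to the second integrability condition: on Q_a it turns I_a into θ_{a+1}, and
brackets of sections of Q become exterior derivatives. -/
theorem d_succ_sub (hθ : S.IsCompatible θ) {U : Set M} (hU : IsOpen U) {X Y : VField n M}
    (hX : IsSectionOn S.Q X U) (hY : IsSectionOn S.Q Y U) {x : M} (hx : x ∈ U) (a : Fin 3) :
    (θ (a + 1)).d x (X x) (Y x) - (θ (a + 1)).d x (S.I a x (X x)) (S.I a x (Y x))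
      = (θ (a + 2)).d x (X x) (S.I a x (Y x)) + (θ (a + 2)).d x (S.I a x (X x)) (Y x) := by
  have hIX := hθ.isSectionOn_I hU hX a
  have hIY := hθ.isSectionOn_I hU hY a
  have h1 := hθ.comp_eq a x _ (S.integrable_mem a U X Y hU hX hY x hx)
  have h2 := hθ.mem_Q_iff.1 (S.integrable_J a U X Y hU hX hY x hx) (a + 2)
  rw [hθ.d_apply_section hU hX hY hx, hθ.d_apply_section hU hIX hIY hx,
    hθ.d_apply_section hU hX hIY hx, hθ.d_apply_section hU hIX hY hx]
  simp only [map_sub] at h1 h2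
  linarith

end IsCompatible

namespace IsAdaptedFrameOn

variable {ε : QuatModel.Idx n → VField n M} {O : Set M}

theorem I_apply (hθ : S.IsCompatible θ) (hε : S.IsAdaptedFrameOn θ ε O) {x : M} (hx : x ∈ O)
    (a : Fin 3) (j : QuatModel.Idx n) :
    S.I a x (ε j x) = ∑ i, QuatModel.I n a i j • ε i x := by
  obtain ⟨k, r⟩ := j
  have hsum : ∑ i, QuatModel.I n a i (k, r) • ε i x
      = ∑ r', QuatModel.quatUnit a r' r • ε (k, r') x := by
    rw [Fintype.sum_prod_type, Finset.sum_eq_single k]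
    · simp [QuatModel.I, Matrix.kroneckerMap_apply]
    · intro k' _ hk'
      simp [QuatModel.I, Matrix.kroneckerMap_apply, Matrix.one_apply_ne hk']
    · simp
  have h0 : ε (k, 0) x ∈ S.Q x := (hε.isSection _).2 x hx
  have hq := hε.quaternionic x hx k
  have h1 : ε (k, 1) x = S.I 0 x (ε (k, 0) x) := hq 0
  have h2 : ε (k, 2) x = S.I 1 x (ε (k, 0) x) := hq 1
  have h3 : ε (k, 3) x = S.I 2 x (ε (k, 0) x) := hq 2
  have hII := IsCompatible.I_I S h0
  have q0 : S.I 0 x (S.I 1 x (ε (k, 0) x)) = S.I 2 x (ε (k, 0) x) := (hθ.quaternion h0 0).1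
  have q1 : S.I 1 x (S.I 2 x (ε (k, 0) x)) = S.I 0 x (ε (k, 0) x) := (hθ.quaternion h0 1).1
  have q2 : S.I 2 x (S.I 0 x (ε (k, 0) x)) = S.I 1 x (ε (k, 0) x) := (hθ.quaternion h0 2).1
  have q0' : S.I 1 x (S.I 0 x (ε (k, 0) x)) = -S.I 2 x (ε (k, 0) x) := (hθ.quaternion h0 0).2
  have q1' : S.I 2 x (S.I 1 x (ε (k, 0) x)) = -S.I 0 x (ε (k, 0) x) := (hθ.quaternion h0 1).2
  have q2' : S.I 0 x (S.I 2 x (ε (k, 0) x)) = -S.I 1 x (ε (k, 0) x) := (hθ.quaternion h0 2).2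
  rw [hsum, Fin.sum_univ_four, h1, h2, h3]
  fin_cases a <;> fin_cases r <;>
    simp [QuatModel.quatUnit, h1, h2, h3, hII, q0, q1, q2, q0', q1', q2']

/-- The matrix of `dθ_a` on `Q` in the frame. -/
noncomputable def _root_.HyperCRStructure.dMatrix (θ : Fin 3 → OneForm n M) (ε : QuatModel.Idx n → VField n M)
    (x : M) (a : Fin 3) : Matrix (QuatModel.Idx n) (QuatModel.Idx n) ℝ :=
  Matrix.of fun i j => (θ a).d x (ε i x) (ε j x)

theorem bilin_I_right (hθ : S.IsCompatible θ) (hε : S.IsAdaptedFrameOn θ ε O) {x : M} (hx : x ∈ O)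
    (B : TangentSpace (𝓡 (4 * n + 3)) x →ₗ[ℝ] TangentSpace (𝓡 (4 * n + 3)) x →ₗ[ℝ] ℝ)
    (b : Fin 3) (i j : QuatModel.Idx n) :
    B (ε i x) (S.I b x (ε j x))
      = ((Matrix.of fun i j => B (ε i x) (ε j x)) * QuatModel.I n b) i j := by
  rw [hε.I_apply hθ hx]
  simp [Matrix.mul_apply, mul_comm]

theorem bilin_I_left (hθ : S.IsCompatible θ) (hε : S.IsAdaptedFrameOn θ ε O) {x : M} (hx : x ∈ O)
    (B : TangentSpace (𝓡 (4 * n + 3)) x →ₗ[ℝ] TangentSpace (𝓡 (4 * n + 3)) x →ₗ[ℝ] ℝ)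
    (b : Fin 3) (i j : QuatModel.Idx n) :
    B (S.I b x (ε i x)) (ε j x)
      = -(QuatModel.I n b * (Matrix.of fun i j => B (ε i x) (ε j x))) i j := by
  rw [hε.I_apply hθ hx, ← Matrix.neg_apply, ← neg_mul, ← QuatModel.I_transpose]
  simp [Matrix.mul_apply, LinearMap.sum_apply]

theorem bilin_I_I (hθ : S.IsCompatible θ) (hε : S.IsAdaptedFrameOn θ ε O) {x : M} (hx : x ∈ O)
    (B : TangentSpace (𝓡 (4 * n + 3)) x →ₗ[ℝ] TangentSpace (𝓡 (4 * n + 3)) x →ₗ[ℝ] ℝ)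
    (b c : Fin 3) (i j : QuatModel.Idx n) :
    B (S.I b x (ε i x)) (S.I c x (ε j x))
      = -(QuatModel.I n b * (Matrix.of fun i j => B (ε i x) (ε j x)) * QuatModel.I n c) i j := by
  have h := hε.bilin_I_left hθ hx (B.compl₂ (S.I c x)) b i j
  simp only [LinearMap.compl₂_apply] at h
  have e : (Matrix.of fun i j => B (ε i x) (S.I c x (ε j x)))
      = (Matrix.of fun i j => B (ε i x) (ε j x)) * QuatModel.I n c := by
    ext i j
    exact hε.bilin_I_right hθ hx B c i j
  rw [h, e, mul_assoc]

theorem dMatrix_transpose (a : Fin 3) (x : M) : (dMatrix θ ε x a)ᵀ = -dMatrix θ ε x a := by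
  ext i j
  exact (θ a).d_swap x _ _

theorem dMatrix_commute (hθ : S.IsCompatible θ) (hO : IsOpen O) (hε : S.IsAdaptedFrameOn θ ε O)
    {x : M} (hx : x ∈ O) (a : Fin 3) :
    dMatrix θ ε x a * QuatModel.I n a = QuatModel.I n a * dMatrix θ ε x a := by
  have h : -(QuatModel.I n a * dMatrix θ ε x a * QuatModel.I n a) = dMatrix θ ε x a := by
    ext i j
    have := hθ.d_I_I hO (hε.isSection i) (hε.isSection j) hx a
    rw [← OneForm.dBilin_apply, hε.bilin_I_I hθ hx] at this
    exact this
  conv_lhs => rw [← h, neg_mul, mul_assoc, QuatModel.I_mul_self, mul_neg, mul_one, neg_neg]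

theorem dMatrix_succ (hθ : S.IsCompatible θ) (hO : IsOpen O) (hε : S.IsAdaptedFrameOn θ ε O)
    {x : M} (hx : x ∈ O) (a : Fin 3) :
    dMatrix θ ε x (a + 1) + QuatModel.I n a * dMatrix θ ε x (a + 1) * QuatModel.I n a
      = dMatrix θ ε x (a + 2) * QuatModel.I n a - QuatModel.I n a * dMatrix θ ε x (a + 2) := by
  ext i j
  have h := hθ.d_succ_sub hO (hε.isSection i) (hε.isSection j) hx a
  simp only [← OneForm.dBilin_apply] at h
  rw [hε.bilin_I_I hθ hx, hε.bilin_I_right hθ hx, hε.bilin_I_left hθ hx, sub_neg_eq_add,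
    ← sub_eq_add_neg] at h
  exact h

theorem dMatrix_levi (hθ : S.IsCompatible θ) (hε : S.IsAdaptedFrameOn θ ε O)
    {x : M} (hx : x ∈ O) :
    dMatrix θ ε x 0 * QuatModel.I n 0 - QuatModel.I n 1 * dMatrix θ ε x 0 * QuatModel.I n 2
      = (2 : ℝ) • 1 := by
  ext i j
  have h := hε.orthonormal x hx i j
  rw [levi, ← OneForm.dBilin_apply, ← OneForm.dBilin_apply, hε.bilin_I_I hθ hx,
    hε.bilin_I_right hθ hx] at h
  have h' : (dMatrix θ ε x 0 * QuatModel.I n 0) i j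
      + -(QuatModel.I n 1 * dMatrix θ ε x 0 * QuatModel.I n 2) i j
      = 2 * (if i = j then 1 else 0) := by
    rw [← h, ← mul_assoc]
    norm_num
    rfl
  rw [Matrix.sub_apply, Matrix.smul_apply, Matrix.one_apply, smul_eq_mul, ← h', sub_eq_add_neg]

end IsAdaptedFrameOn

end HyperCRStructure

/-! ### Frame expansions and smoothness -/

namespace HyperCRStructure

variable {n : ℕ} {M : Type*} [TopologicalSpace M]
  [ChartedSpace (EuclideanSpace ℝ (Fin (4 * n + 3))) M] [IsManifold (𝓡 (4 * n + 3)) ∞ M]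
  {S : HyperCRStructure n M} {θ : Fin 3 → OneForm n M} {T : Fin 3 → VField n M}

theorem IsAdmissibleTriple.form_apply (hT : S.IsAdmissibleTriple T) (hθ : S.IsCompatible θ)
    (hTn : ∀ a x, θ a x (T a x) = 1) (a b : Fin 3) (x : M) :
    θ a x (T b x) = if a = b then 1 else 0 := by
  rcases QuatModel.fin_three_cases b a with rfl | rfl | rfl
  · simp [hTn]
  · rw [if_neg (by fin_cases b <;> decide)]
    exact (hθ.ker_eq _ x _).2 (hT.mem_left b x)
  · rw [if_neg (by fin_cases b <;> decide)]
    exact (hθ.ker_eq _ x _).2 (hT.mem_right b x)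

namespace IsAdaptedFrameOn

variable {ε : QuatModel.Idx n → VField n M} {O : Set M}

theorem linearIndependent (hθ : S.IsCompatible θ) (hT : S.IsAdmissibleTriple T)
    (hTn : ∀ a x, θ a x (T a x) = 1) (hε : S.IsAdaptedFrameOn θ ε O) {x : M} (hx : x ∈ O) :
    LinearIndependent ℝ (Sum.elim (fun i => ε i x) (fun a => T a x) :
      QuatModel.Idx n ⊕ Fin 3 → TangentSpace (𝓡 (4 * n + 3)) x) := by
  rw [Fintype.linearIndependent_iff]
  intro g hg
  rw [Fintype.sum_sum_type] at hg
  simp only [Sum.elim_inl, Sum.elim_inr] at hg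
  have hT0 : ∀ a, g (Sum.inr a) = 0 := by
    intro a
    have h := congrArg (θ a x) hg
    simp only [map_add, map_sum, map_smul, map_zero, hT.form_apply hθ hTn,
      hθ.mem_Q_iff.1 ((hε.isSection _).2 x hx) a] at h
    simpa using h
  have hε0 : ∀ i, g (Sum.inl i) = 0 := by
    intro i
    simp only [hT0, zero_smul, Finset.sum_const_zero, add_zero] at hg
    have h := congrArg (S.leviBilin θ x (ε i x)) hg
    simp only [map_sum, map_smul, map_zero, leviBilin_apply, hε.orthonormal x hx] at h
    simpa using h
  rintro (i | a)
  · exact hε0 i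
  · exact hT0 a

/-- By the dimension count 4n + 3, the frame and the triple form a basis of the tangent space. The
forms θ_a then kill the T-coefficients of a vector of Q. -/
theorem eq_sum (hθ : S.IsCompatible θ) (hT : S.IsAdmissibleTriple T)
    (hTn : ∀ a x, θ a x (T a x) = 1) (hε : S.IsAdaptedFrameOn θ ε O) {x : M} (hx : x ∈ O)
    {v : TangentSpace (𝓡 (4 * n + 3)) x} (hv : v ∈ S.Q x) :
    v = ∑ i, S.levi θ x v (ε i x) • ε i x := by
  have hcard : Fintype.card (QuatModel.Idx n ⊕ Fin 3)
      = Module.finrank ℝ (TangentSpace (𝓡 (4 * n + 3)) x) := by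
    rw [show Module.finrank ℝ (TangentSpace (𝓡 (4 * n + 3)) x)
      = Module.finrank ℝ (EuclideanSpace ℝ (Fin (4 * n + 3))) from rfl]
    simp [mul_comm]
  let b := basisOfLinearIndependentOfCardEqFinrank (hε.linearIndependent hθ hT hTn hx) hcard
  have hb := b.sum_repr v
  rw [Fintype.sum_sum_type] at hb
  simp only [b, coe_basisOfLinearIndependentOfCardEqFinrank, Sum.elim_inl, Sum.elim_inr] at hb
  set g := b.repr v with hg
  have hT0 : ∀ a, g (Sum.inr a) = 0 := by
    intro a
    have h := congrArg (θ a x) hb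
    simp only [map_add, map_sum, map_smul, hT.form_apply hθ hTn,
      hθ.mem_Q_iff.1 ((hε.isSection _).2 x hx) a, hθ.mem_Q_iff.1 hv a] at h
    simpa using h
  have hb' : ∑ i, g (Sum.inl i) • ε i x = v := by
    refine Eq.trans ?_ hb
    simp only [hT0, zero_smul, Finset.sum_const_zero, add_zero]
  have hε0 : ∀ i, S.levi θ x v (ε i x) = g (Sum.inl i) := by
    intro i
    rw [← hb', ← leviBilin_apply]
    simp [LinearMap.sum_apply, leviBilin_apply, hε.orthonormal x hx]
  simp only [hε0, hb']

end IsAdaptedFrameOn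

section Smoothness

theorem _root_.OneForm.SmoothOn.apply {η : OneForm n M} {U : Set M} (hη : η.SmoothOn U)
    {X : VField n M} (hX : X.SmoothOn U) :
    ContMDiffOn (𝓡 (4 * n + 3)) 𝓘(ℝ, ℝ) ∞ (fun y => η y (X y)) U := by
  intro x hx
  have h := (hη x hx).clm_bundle_apply (hX x hx)
  rw [Bundle.contMDiffWithinAt_section] at h
  exact h

/-- `OneForm.d` is computed in a chart that depends on the point, so smoothness is read off from
dθ(X,Y) = -θ([X,Y]) instead. -/
theorem IsCompatible.contMDiffOn_levi (hθ : S.IsCompatible θ) {U : Set M} (hU : IsOpen U)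
    {X Y : VField n M} (hX : IsSectionOn S.Q X U) (hY : IsSectionOn S.Q Y U) :
    ContMDiffOn (𝓡 (4 * n + 3)) 𝓘(ℝ, ℝ) ∞ (fun y => S.levi θ y (X y) (Y y)) U := by
  have h : ∀ X Y : VField n M, IsSectionOn S.Q X U → IsSectionOn S.Q Y U →
      ContMDiffOn (𝓡 (4 * n + 3)) 𝓘(ℝ, ℝ) ∞ (fun y => (θ 0).d y (X y) (Y y)) U := by
    intro X Y hX hY
    have hb : VField.SmoothOn (mlieBracket (𝓡 (4 * n + 3)) X Y) U := by
      intro x hx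
      have hX' := (hX.1 x hx).contMDiffAt (hU.mem_nhds hx)
      have hY' := (hY.1 x hx).contMDiffAt (hU.mem_nhds hx)
      have : IsManifold (𝓡 (4 * n + 3)) (((⊤ : ℕ∞) : WithTop ℕ∞) + 1) M := by
        simpa using ‹IsManifold (𝓡 (4 * n + 3)) ∞ M›
      have : IsManifold (𝓡 (4 * n + 3)) (minSmoothness ℝ 2) M := by
        rw [minSmoothness_of_isRCLikeNormedField]
        infer_instance
      exact (ContMDiffAt.mlieBracket_vectorField (m := ⊤) (n := ⊤) hX' hY'
        (by simp)).contMDiffWithinAt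
    have hs : (θ 0).SmoothOn U := fun y _ => ((hθ.smooth 0) y trivial).mono (subset_univ _)
    exact (hs.apply hb).neg.congr fun y hy => hθ.d_apply_section hU hX hY hy 0
  exact contMDiffOn_const.mul ((h _ _ hX (hθ.isSectionOn_I hU hY 0)).add
    (h _ _ (hθ.isSectionOn_I hU hX 1) (hθ.isSectionOn_I hU hY 2)))

end Smoothness

theorem connection_sum (cov : Connection n M) {ι : Type*} (s : Finset ι) {c : ι → M → ℝ}
    {X : ι → VField n M} {x : M}
    (hc : ∀ i, MDifferentiableAt (𝓡 (4 * n + 3)) 𝓘(ℝ, ℝ) (c i) x)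
    (hX : ∀ i, MDifferentiableAt (𝓡 (4 * n + 3)) (𝓡 (4 * n + 3)).tangent
      (fun y => (⟨y, X i y⟩ : TangentBundle (𝓡 (4 * n + 3)) M)) x)
    (v : TangentSpace (𝓡 (4 * n + 3)) x) :
    cov (fun y => ∑ i ∈ s, c i y • X i y) x v
      = ∑ i ∈ s, (c i x • cov (X i) x v + mvfderiv (𝓡 (4 * n + 3)) (c i) x v • X i x) := by
  classical
  induction s using Finset.induction_on with
  | empty =>
    simp only [Finset.sum_empty]
    have h := congrFun cov.zero x
    exact congrArg (fun A : TangentSpace (𝓡 (4 * n + 3)) x →L[ℝ] TangentSpace (𝓡 (4 * n + 3)) x =>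
      A v) h
  | insert i s hi ih =>
    simp only [Finset.sum_insert hi]
    rw [← ih]
    have h1 := cov.isCovariantDerivativeOnUniv.add (x := x)
      ((hc i).smul_section (hX i))
      (MDifferentiableAt.sum_section (s := s) fun j _ => (hc j).smul_section (hX j))
    have h2 := cov.isCovariantDerivativeOnUniv.leibniz (hX i) (hc i)
    have h3 := congrArg (fun A : TangentSpace (𝓡 (4 * n + 3)) x →L[ℝ]
      TangentSpace (𝓡 (4 * n + 3)) x => A v) h1
    have h4 := congrArg (fun A : TangentSpace (𝓡 (4 * n + 3)) x →L[ℝ]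
      TangentSpace (𝓡 (4 * n + 3)) x => A v) h2
    refine h3.trans ?_
    exact congrArg₂ (· + ·) h4 rfl

end HyperCRStructure

/-! ### Conformally related compatible forms and their triples -/

namespace HyperCRStructure

variable {n : ℕ} {M : Type*} [TopologicalSpace M]
  [ChartedSpace (EuclideanSpace ℝ (Fin (4 * n + 3))) M] [IsManifold (𝓡 (4 * n + 3)) ∞ M]
  {S : HyperCRStructure n M} {θ θ' : Fin 3 → OneForm n M} {T T' : Fin 3 → VField n M}

theorem IsAdaptedFrameOn.exists_section (hθ : S.IsCompatible θ) (hT : S.IsAdmissibleTriple T)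
    (hTn : ∀ a x, θ a x (T a x) = 1) {ε : QuatModel.Idx n → VField n M} {O : Set M}
    (hε : S.IsAdaptedFrameOn θ ε O) {x : M} (hx : x ∈ O)
    {v : TangentSpace (𝓡 (4 * n + 3)) x} (hv : v ∈ S.Q x) :
    ∃ X : VField n M, IsSectionOn S.Q X O ∧ X x = v := by
  refine ⟨fun y => ∑ i, S.levi θ x v (ε i x) • ε i y, ⟨?_, fun y hy => ?_⟩,
    (hε.eq_sum hθ hT hTn hx hv).symm⟩
  · exact ContMDiffOn.sum_section fun i _ => ((hε.isSection i).1).const_smul_section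
  · exact Submodule.sum_mem _ fun i _ => Submodule.smul_mem _ _ ((hε.isSection i).2 y hy)

/-- Two compatible forms differ by a nonvanishing factor. -/
theorem IsCompatible.exists_smul (hθ : S.IsCompatible θ) (hθ' : S.IsCompatible θ')
    (hT : S.IsAdmissibleTriple T) (hTn : ∀ a x, θ a x (T a x) = 1) (x : M) :
    ∃ c : ℝ, c ≠ 0 ∧ ∀ a, θ' a x = c • θ a x := by
  -- Compatibility of θ' and I_a T_b = T_c force the three values θ'_a(T_a) to agree; their common
  -- value is the factor.
  have hs : ∀ a, θ' (a + 2) x (T (a + 2) x) = θ' (a + 1) x (T (a + 1) x) := fun a => by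
    have h := hT.mem_right (a + 1) x
    rw [show a + 1 + 2 = a by fin_cases a <;> decide] at h
    rw [← hT.I_apply a x]
    exact hθ'.comp_eq a x _ h
  have h1 : θ' 2 x (T 2 x) = θ' 1 x (T 1 x) := hs 0
  have h2 : θ' 0 x (T 0 x) = θ' 2 x (T 2 x) := hs 1
  have he : ∀ a, θ' a x (T a x) = θ' 0 x (T 0 x) := fun a => by
    fin_cases a
    · rfl
    · exact (h2.trans h1).symm
    · exact h2.symm
  refine ⟨θ' 0 x (T 0 x), fun h0 => ?_, fun a => ?_⟩
  · have := (hθ.ker_eq 0 x _).2 ((hθ'.ker_eq 0 x _).1 h0)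
    rw [hTn] at this
    exact one_ne_zero this
  · ext v
    have hv : θ a x (v - θ a x v • T a x) = 0 := by
      rw [map_sub, map_smul, hTn, smul_eq_mul, mul_one, sub_self]
    have hv' := (hθ'.ker_eq a x _).2 ((hθ.ker_eq a x _).1 hv)
    rw [map_sub, map_smul, he, sub_eq_zero] at hv'
    rw [hv', smul_apply, smul_eq_mul, smul_eq_mul, mul_comm]

section Rescaling

variable {ε : QuatModel.Idx n → VField n M} {O : Set M} {x : M} {c : ℝ}

/-- On Q the value dθ(X,Y) = -θ([X,Y]) depends on θ only at the point. Proportionality at x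
therefore suffices, and no derivative of the factor enters. -/
theorem IsCompatible.d_smul (hθ : S.IsCompatible θ) (hθ' : S.IsCompatible θ')
    (hT : S.IsAdmissibleTriple T) (hTn : ∀ a x, θ a x (T a x) = 1) (hO : IsOpen O)
    (hε : S.IsAdaptedFrameOn θ ε O) (hx : x ∈ O) (hc : ∀ a, θ' a x = c • θ a x)
    {u v : TangentSpace (𝓡 (4 * n + 3)) x} (hu : u ∈ S.Q x) (hv : v ∈ S.Q x) (a : Fin 3) :
    (θ' a).d x u v = c * (θ a).d x u v := by
  obtain ⟨X, hX, rfl⟩ := hε.exists_section hθ hT hTn hx hu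
  obtain ⟨Y, hY, rfl⟩ := hε.exists_section hθ hT hTn hx hv
  rw [hθ.d_apply_section hO hX hY hx, hθ'.d_apply_section hO hX hY hx, hc,
    smul_apply, smul_eq_mul, mul_neg]

theorem IsCompatible.levi_smul (hθ : S.IsCompatible θ) (hθ' : S.IsCompatible θ')
    (hT : S.IsAdmissibleTriple T) (hTn : ∀ a x, θ a x (T a x) = 1) (hO : IsOpen O)
    (hε : S.IsAdaptedFrameOn θ ε O) (hx : x ∈ O) (hc : ∀ a, θ' a x = c • θ a x)
    {u v : TangentSpace (𝓡 (4 * n + 3)) x} (hu : u ∈ S.Q x) (hv : v ∈ S.Q x) :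
    S.levi θ' x u v = c * S.levi θ x u v := by
  rw [levi, levi, hθ.d_smul hθ' hT hTn hO hε hx hc hu (hθ.I_mem_Q hv 0),
    hθ.d_smul hθ' hT hTn hO hε hx hc (hθ.I_mem_Q hu 1) (hθ.I_mem_Q hv 2)]
  ring

theorem IsCompatible.h_smul (hθ : S.IsCompatible θ) (hθ' : S.IsCompatible θ')
    (hT : S.IsAdmissibleTriple T) (hTn : ∀ a x, θ a x (T a x) = 1) (hO : IsOpen O)
    (hε : S.IsAdaptedFrameOn θ ε O) (hx : x ∈ O) (hc : ∀ a, θ' a x = c • θ a x)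
    {u v : TangentSpace (𝓡 (4 * n + 3)) x} (hu : u ∈ S.Q x) (hv : v ∈ S.Q x) :
    S.h θ' x u v = c * S.h θ x u v := by
  rw [h, h, hθ.levi_smul hθ' hT hTn hO hε hx hc hu hv]
  simp only [hθ.d_smul hθ' hT hTn hO hε hx hc hu (hθ.I_mem_Q hv _), ← Finset.mul_sum]
  ring

/-- On an ultra-pseudoconvex structure the form `h` of any compatible form is nondegenerate. -/
theorem IsUltraPseudoconvex.eq_zero (hS : S.IsUltraPseudoconvex) (hθ : S.IsCompatible θ)
    (hT : S.IsAdmissibleTriple T) (hTn : ∀ a x, θ a x (T a x) = 1) (hO : IsOpen O)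
    (hε : S.IsAdaptedFrameOn θ ε O) (hx : x ∈ O)
    {u : TangentSpace (𝓡 (4 * n + 3)) x} (hu : u ∈ S.Q x)
    (h0 : ∀ v ∈ S.Q x, S.h θ x u v = 0) : u = 0 := by
  obtain ⟨θ₀, hθ₀, hdef⟩ := hS
  obtain ⟨c, -, hc⟩ := hθ.exists_smul hθ₀ hT hTn x
  have e : S.h θ₀ x u u = 0 := by
    rw [hθ.h_smul hθ₀ hT hTn hO hε hx hc hu hu, h0 u hu, mul_zero]
  by_contra hne
  rcases hdef with h | h
  · exact (h x u hu hne).ne' e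
  · exact (h x u hu hne).ne e

end Rescaling

theorem IsCompatible.rescale (hθ : S.IsCompatible θ) {c : M → ℝ}
    (hc : ContMDiff (𝓡 (4 * n + 3)) 𝓘(ℝ, ℝ) ∞ c) (hc0 : ∀ x, c x ≠ 0)
    (hθ' : ∀ a x, θ' a x = c x • θ a x) : S.IsCompatible θ' where
  smooth a := by
    have h := hc.contMDiffOn.smul_section (hθ.smooth a)
    rw [show θ' a = fun x => c x • θ a x from funext (hθ' a)]
    exact h
  ker_eq a x v := by
    rw [hθ', ← hθ.ker_eq a x v, smul_apply, smul_eq_mul, mul_eq_zero,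
      or_iff_right (hc0 x)]
  comp_eq a x v hv := by
    rw [hθ', hθ', smul_apply, smul_apply,
      hθ.comp_eq a x v hv]

/-- Normalized admissible triples of conformally related forms differ by a section of `Q`. -/
theorem IsAdmissibleTriple.exists_section (hθ : S.IsCompatible θ) {c : M → ℝ}
    (hc : ContMDiff (𝓡 (4 * n + 3)) 𝓘(ℝ, ℝ) ∞ c) (hc0 : ∀ x, c x ≠ 0)
    (hθ' : ∀ a x, θ' a x = c x • θ a x)
    (hT : S.IsAdmissibleTriple T) (hTn : ∀ a x, θ a x (T a x) = 1)
    (hT' : S.IsAdmissibleTriple T') (hTn' : ∀ a x, θ' a x (T' a x) = 1) :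
    ∃ W : VField n M, IsSectionOn S.Q W univ ∧
      ∀ a x, c x • T' a x = T a x + (2 : ℝ) • S.I a x (W x) := by
  have hθc := hθ.rescale hc hc0 hθ'
  let V : Fin 3 → VField n M := fun a x => c x • T' a x - T a x
  have hVQ : ∀ a x, V a x ∈ S.Q x := fun a x => by
    rw [hθ.mem_Q_iff]
    intro b
    have h := hT'.form_apply hθc hTn' b a x
    rw [hθ', smul_apply] at h
    rw [map_sub, map_smul, h, hT.form_apply hθ hTn, sub_self]
  have hVI : ∀ a x, S.I a x (V (a + 1) x) = V (a + 2) x := fun a x => by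
    simp only [V, map_sub, map_smul, hT.I_apply, hT'.I_apply]
  have hV : IsSectionOn S.Q (V 0) univ :=
    ⟨(hc.contMDiffOn.smul_section (hT'.smooth 0)).sub_section (hT.smooth 0), fun x _ => hVQ 0 x⟩
  have hIV := hθ.isSectionOn_I isOpen_univ hV 0
  -- W is the solution of 2 I W = V₁, where V_a = e^{2f}T'_a - T_a in the application. The equations
  -- for J and K then follow from I_a V_b = V_c and the quaternion relations.
  refine ⟨fun x => (-(1 / 2) : ℝ) • S.I 0 x (V 0 x), ⟨hIV.1.const_smul_section,
    fun x hx => Submodule.smul_mem _ _ (hIV.2 x hx)⟩, fun a x => ?_⟩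
  suffices h : ∀ a, V a x = (2 : ℝ) • S.I a x ((-(1 / 2) : ℝ) • S.I 0 x (V 0 x)) by
    rw [← h a]
    simp only [V]
    abel
  have e : ∀ a, (2 : ℝ) • S.I a x ((-(1 / 2) : ℝ) • S.I 0 x (V 0 x))
      = -S.I a x (S.I 0 x (V 0 x)) := fun a => by
    rw [map_smul, smul_smul, show (2 : ℝ) * -(1 / 2) = -1 by norm_num, neg_one_smul]
  simp only [e]
  have h1 : S.I 2 x (V 0 x) = V 1 x := hVI 2 x
  have h2 : S.I 1 x (V 0 x) = -V 2 x := by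
    rw [← show S.I 1 x (V 2 x) = V 0 x from hVI 1 x, IsCompatible.I_I S (hVQ 2 x)]
  intro a
  fin_cases a
  · change V 0 x = -S.I 0 x (S.I 0 x (V 0 x))
    rw [IsCompatible.I_I S (hVQ 0 x), neg_neg]
  · change V 1 x = -S.I 1 x (S.I 0 x (V 0 x))
    rw [show S.I 1 x (S.I 0 x (V 0 x)) = -S.I 2 x (V 0 x) from (hθ.quaternion (hVQ 0 x) 0).2,
      neg_neg, h1]
  · change V 2 x = -S.I 2 x (S.I 0 x (V 0 x))
    rw [show S.I 2 x (S.I 0 x (V 0 x)) = S.I 1 x (V 0 x) from (hθ.quaternion (hVQ 0 x) 2).1,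
      h2, neg_neg]

end HyperCRStructure

/-! ### Change of frame -/

namespace QuatModel

variable {n : ℕ}

/-- √c A is orthogonal and commutes with I, J, K, so the homogeneous part of the gauge
transformation is an Sp(n)-action up to scale. The inhomogeneous part Aᵀ dA commutes with I, J, K,
and the contraction kills it. -/
theorem contraction_eq_zero_of_frame_change {A : Matrix (Idx n) (Idx n) ℝ} {c : ℝ} (hc : 0 < c)
    (hAA : c • (Aᵀ * A) = 1) (hA : ∀ a, A * I n a = I n a * A) {dA Γ : Tensor n}
    (hdA : ∀ l a, dA l * I n a = I n a * dA l)
    (h : contraction n (fun k => ∑ l, (c * A l k) • (Aᵀ * Γ l * A + Aᵀ * dA l)) = 0) :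
    contraction n Γ = 0 := by
  obtain ⟨s, hs, rfl⟩ : ∃ s : ℝ, 0 < s ∧ s * s = c := ⟨√c, by positivity, Real.mul_self_sqrt hc.le⟩
  have hAt : ∀ a, Aᵀ * I n a = I n a * Aᵀ := fun a => by
    have := congrArg Matrix.transpose (hA a)
    rw [Matrix.transpose_mul, Matrix.transpose_mul, I_transpose, neg_mul, mul_neg, neg_inj] at this
    exact this.symm
  have hg' : (s • A)ᵀ * (s • A) = 1 := by
    rw [← hAA, Matrix.transpose_smul, smul_mul_assoc, mul_smul_comm, smul_smul]
  have hg : (s • Aᵀ)ᵀ * (s • Aᵀ) = 1 := by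
    rw [Matrix.transpose_smul, Matrix.transpose_transpose]
    rw [Matrix.transpose_smul] at hg'
    exact mul_eq_one_comm.1 hg'
  -- The action of s Aᵀ carries three factors s, the gauge transformation only two; hence s⁻¹.
  have hdecomp : (fun k => ∑ l, (s * s * A l k) • (Aᵀ * Γ l * A + Aᵀ * dA l))
      = s⁻¹ • act (s • Aᵀ) Γ + fun k => ∑ l, (s * s * A l k) • (Aᵀ * dA l) := by
    funext k
    simp only [act, Pi.add_apply, Pi.smul_apply, Finset.smul_sum, ← Finset.sum_add_distrib]
    refine Finset.sum_congr rfl fun l _ => ?_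
    rw [Matrix.transpose_smul, Matrix.transpose_transpose, smul_add]
    congr 1
    simp only [Matrix.smul_apply, Matrix.transpose_apply, smul_mul_assoc, mul_smul_comm, smul_smul,
      smul_eq_mul]
    congr 1
    field_simp
  have hcomm : contraction n (fun k => ∑ l, (s * s * A l k) • (Aᵀ * dA l)) = 0 :=
    contraction_of_commute fun k a => by
      rw [Finset.sum_mul, Finset.mul_sum]
      refine Finset.sum_congr rfl fun l _ => ?_
      have e : Aᵀ * dA l * I n a = I n a * (Aᵀ * dA l) := by
        rw [mul_assoc, hdA l a, ← mul_assoc, hAt, mul_assoc]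
      rw [smul_mul_assoc, mul_smul_comm, e]
  rw [hdecomp, map_add, hcomm, add_zero, map_smul, smul_eq_zero, or_iff_right (inv_ne_zero hs.ne'),
    contraction_act hg (R := 1) (by simp) (fun a => ?_)] at h
  · have := congrArg (fun v => (s • A) *ᵥ v) h
    simpa only [Matrix.mulVec_mulVec, Matrix.mulVec_zero, ← Matrix.transpose_smul,
      mul_eq_one_comm.1 hg', Matrix.one_mulVec] using this
  · have e : I n a * (s • Aᵀ) = s • Aᵀ * I n a := by
      rw [smul_mul_assoc, mul_smul_comm, hAt]
    have e' : (s • Aᵀ)ᵀ * I n a * (s • Aᵀ) = I n a := by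
      rw [mul_assoc, e, ← mul_assoc, hg, one_mul]
    rw [e']
    simp [Matrix.one_apply]

end QuatModel

section Derivative

variable {n : ℕ} {M : Type*} [TopologicalSpace M]
  [ChartedSpace (EuclideanSpace ℝ (Fin (4 * n + 3))) M]

theorem mvfderiv_congr {f g : M → ℝ} {x : M} (h : f =ᶠ[𝓝 x] g)
    (v : TangentSpace (𝓡 (4 * n + 3)) x) :
    mvfderiv (𝓡 (4 * n + 3)) f x v = mvfderiv (𝓡 (4 * n + 3)) g x v :=
  congrArg (fun A : EuclideanSpace ℝ (Fin (4 * n + 3)) →L[ℝ] ℝ => A v) h.mfderiv_eq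

theorem mvfderiv_comp_real {f : M → ℝ} {x : M} {g : ℝ → ℝ} {g' : ℝ} (hg : HasDerivAt g g' (f x))
    (hf : MDifferentiableAt (𝓡 (4 * n + 3)) 𝓘(ℝ, ℝ) f x) (v : TangentSpace (𝓡 (4 * n + 3)) x) :
    mvfderiv (𝓡 (4 * n + 3)) (fun y => g (f y)) x v = g' * mvfderiv (𝓡 (4 * n + 3)) f x v := by
  have h := (hg.hasFDerivAt.hasMFDerivAt.comp x hf.hasMFDerivAt).mfderiv
  have h' := congrArg (fun A : EuclideanSpace ℝ (Fin (4 * n + 3)) →L[ℝ] ℝ => A v) h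
  exact h'.trans (mul_comm (mvfderiv (𝓡 (4 * n + 3)) f x v) g')

theorem mvfderiv_sum_const_mul {ι : Type*} (s : Finset ι) (a : ι → ℝ) {F : ι → M → ℝ} {x : M}
    (hF : ∀ i, MDifferentiableAt (𝓡 (4 * n + 3)) 𝓘(ℝ, ℝ) (F i) x) :
    MDifferentiableAt (𝓡 (4 * n + 3)) 𝓘(ℝ, ℝ) (fun y => ∑ i ∈ s, a i * F i y) x ∧
      ∀ v : TangentSpace (𝓡 (4 * n + 3)) x,
        mvfderiv (𝓡 (4 * n + 3)) (fun y => ∑ i ∈ s, a i * F i y) x v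
          = ∑ i ∈ s, a i * mvfderiv (𝓡 (4 * n + 3)) (F i) x v := by
  classical
  induction s using Finset.induction_on with
  | empty => simp [mvfderiv_const, mdifferentiableAt_const]
  | insert i s hi ih =>
    have hd : MDifferentiableAt (𝓡 (4 * n + 3)) 𝓘(ℝ, ℝ) (fun y => a i * F i y) x :=
      mdifferentiableAt_const.mul (hF i)
    simp only [Finset.sum_insert hi]
    refine ⟨hd.add ih.1, fun v => ?_⟩
    rw [mvfderiv_fun_add hd ih.1, mvfderiv_fun_mul mdifferentiableAt_const (hF i),
      mvfderiv_const, ← ih.2]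
    simp

end Derivative

namespace HyperCRStructure

variable {n : ℕ} {M : Type*} [TopologicalSpace M]
  [ChartedSpace (EuclideanSpace ℝ (Fin (4 * n + 3))) M] [IsManifold (𝓡 (4 * n + 3)) ∞ M]
  {S : HyperCRStructure n M} {θ θ' : Fin 3 → OneForm n M} {T : Fin 3 → VField n M}

/-- The transition matrix from the frame `ε` to the frame `ε'` of `Q`. -/
noncomputable def transition (S : HyperCRStructure n M) (θ : Fin 3 → OneForm n M)
    (ε ε' : QuatModel.Idx n → VField n M) (x : M) :
    Matrix (QuatModel.Idx n) (QuatModel.Idx n) ℝ :=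
  Matrix.of fun i j => S.levi θ x (ε' j x) (ε i x)

section Transition

variable {ε ε' : QuatModel.Idx n → VField n M} {O O' : Set M} {x : M}

theorem transition_sum (hθ : S.IsCompatible θ) (hT : S.IsAdmissibleTriple T)
    (hTn : ∀ a x, θ a x (T a x) = 1) (hε : S.IsAdaptedFrameOn θ ε O)
    (hε' : S.IsAdaptedFrameOn θ' ε' O') (hx : x ∈ O) (hx' : x ∈ O') (j : QuatModel.Idx n) :
    ε' j x = ∑ i, S.transition θ ε ε' x i j • ε i x :=
  hε.eq_sum hθ hT hTn hx ((hε'.isSection j).2 x hx')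

theorem levi_frame_sum (hε : S.IsAdaptedFrameOn θ ε O) (hx : x ∈ O) (c : QuatModel.Idx n → ℝ)
    (i : QuatModel.Idx n) : S.levi θ x (∑ j, c j • ε j x) (ε i x) = c i := by
  rw [← leviBilin_apply]
  simp [LinearMap.sum_apply, leviBilin_apply, hε.orthonormal x hx]

theorem transition_commute (hθ : S.IsCompatible θ) (hθ' : S.IsCompatible θ')
    (hT : S.IsAdmissibleTriple T)
    (hTn : ∀ a x, θ a x (T a x) = 1) (hε : S.IsAdaptedFrameOn θ ε O)
    (hε' : S.IsAdaptedFrameOn θ' ε' O') (hx : x ∈ O) (hx' : x ∈ O') (a : Fin 3) :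
    S.transition θ ε ε' x * QuatModel.I n a = QuatModel.I n a * S.transition θ ε ε' x := by
  have hs := transition_sum hθ hT hTn hε hε' hx hx'
  ext i j
  have h1 : S.I a x (ε' j x)
      = ∑ l, (S.transition θ ε ε' x * QuatModel.I n a) l j • ε l x := by
    rw [hε'.I_apply hθ' hx' a j]
    simp only [hs, Finset.smul_sum, smul_smul, Matrix.mul_apply, Finset.sum_smul]
    rw [Finset.sum_comm]
    simp only [mul_comm]
  have h2 : S.I a x (ε' j x)
      = ∑ l, (QuatModel.I n a * S.transition θ ε ε' x) l j • ε l x := by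
    rw [hs j, map_sum]
    simp only [map_smul, hε.I_apply hθ hx a, Finset.smul_sum, smul_smul, Matrix.mul_apply,
      Finset.sum_smul]
    rw [Finset.sum_comm]
    simp only [mul_comm]
  rw [← levi_frame_sum hε hx (fun l => (S.transition θ ε ε' x * QuatModel.I n a) l j) i, ← h1, h2,
    levi_frame_sum hε hx]

theorem transition_orthogonal (hθ : S.IsCompatible θ) (hθ' : S.IsCompatible θ')
    (hT : S.IsAdmissibleTriple T) (hTn : ∀ a x, θ a x (T a x) = 1) (hO : IsOpen O)
    (hε : S.IsAdaptedFrameOn θ ε O)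
    (hε' : S.IsAdaptedFrameOn θ' ε' O') (hx : x ∈ O) (hx' : x ∈ O') {c : ℝ}
    (hc : ∀ a, θ' a x = c • θ a x) :
    c • ((S.transition θ ε ε' x)ᵀ * S.transition θ ε ε' x) = 1 := by
  ext i j
  have h := hε'.orthonormal x hx' j i
  rw [hθ.levi_smul hθ' hT hTn hO hε hx hc ((hε'.isSection j).2 x hx')
    ((hε'.isSection i).2 x hx'), transition_sum hθ hT hTn hε hε' hx hx' i, ← leviBilin_apply] at h
  rw [Matrix.one_apply, show (if i = j then (1 : ℝ) else 0) = if j = i then 1 else 0 by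
    simp only [eq_comm], ← h]
  simp [Matrix.mul_apply, leviBilin_apply, transition]

theorem mdifferentiableAt_transition (hθ : S.IsCompatible θ) (hO : IsOpen O) (hO' : IsOpen O')
    (hε : S.IsAdaptedFrameOn θ ε O)
    (hε' : S.IsAdaptedFrameOn θ' ε' O') (hx : x ∈ O) (hx' : x ∈ O') (i j : QuatModel.Idx n) :
    MDifferentiableAt (𝓡 (4 * n + 3)) 𝓘(ℝ, ℝ) (fun y => S.transition θ ε ε' y i j) x := by
  have hU := hO.inter hO'
  have h := hθ.contMDiffOn_levi hU
    (X := ε' j) (Y := ε i) ⟨(hε'.isSection j).1.mono inter_subset_right,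
      fun y hy => (hε'.isSection j).2 y hy.2⟩ ⟨(hε.isSection i).1.mono inter_subset_left,
      fun y hy => (hε.isSection i).2 y hy.1⟩
  exact (h.contMDiffAt (hU.mem_nhds ⟨hx, hx'⟩)).mdifferentiableAt (by simp)

/-- The derivative of the transition matrix in the directions of the frame. -/
noncomputable def dTransition (S : HyperCRStructure n M) (θ : Fin 3 → OneForm n M)
    (ε ε' : QuatModel.Idx n → VField n M) (x : M) : QuatModel.Tensor n :=
  fun l => Matrix.of fun i j =>
    mvfderiv (𝓡 (4 * n + 3)) (fun y => S.transition θ ε ε' y i j) x (ε l x)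

/-- Differentiate the relation A I_a = I_a A, which holds on a neighbourhood and has constant
matrices I_a. -/
theorem dTransition_commute (hθ : S.IsCompatible θ) (hθ' : S.IsCompatible θ')
    (hT : S.IsAdmissibleTriple T) (hTn : ∀ a x, θ a x (T a x) = 1) (hO : IsOpen O)
    (hO' : IsOpen O') (hε : S.IsAdaptedFrameOn θ ε O)
    (hε' : S.IsAdaptedFrameOn θ' ε' O') (hx : x ∈ O) (hx' : x ∈ O') (l : QuatModel.Idx n)
    (a : Fin 3) : S.dTransition θ ε ε' x l * QuatModel.I n a
      = QuatModel.I n a * S.dTransition θ ε ε' x l := by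
  have hd := mdifferentiableAt_transition hθ hO hO' hε hε' hx hx'
  ext i j
  have h : (fun y => ∑ p, QuatModel.I n a p j * S.transition θ ε ε' y i p)
      =ᶠ[𝓝 x] fun y => ∑ p, QuatModel.I n a i p * S.transition θ ε ε' y p j := by
    filter_upwards [(hO.inter hO').mem_nhds ⟨hx, hx'⟩] with y hy
    have := congrFun (congrFun (transition_commute hθ hθ' hT hTn hε hε' hy.1 hy.2 a) i) j
    simp only [Matrix.mul_apply] at this
    rw [← this]
    simp only [mul_comm]
  have h2 := mvfderiv_congr h (ε l x)
  rw [(mvfderiv_sum_const_mul Finset.univ _ fun p => hd i p).2,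
    (mvfderiv_sum_const_mul Finset.univ _ fun p => hd p j).2] at h2
  simp only [Matrix.mul_apply]
  rw [show ∑ p, QuatModel.I n a i p * S.dTransition θ ε ε' x l p j = _ from h2.symm]
  exact Finset.sum_congr rfl fun p _ => mul_comm _ _

/-- This is the gauge transformation A⁻¹ΓA + A⁻¹dA, with A⁻¹ = c Aᵀ and with the direction ε'_k
expanded in the frame ε. -/
theorem connectionMatrix_transition (hθ : S.IsCompatible θ) (hθ' : S.IsCompatible θ')
    (hT : S.IsAdmissibleTriple T) (hTn : ∀ a x, θ a x (T a x) = 1) (hO : IsOpen O)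
    (hO' : IsOpen O') (hε : S.IsAdaptedFrameOn θ ε O)
    (hε' : S.IsAdaptedFrameOn θ' ε' O') (hx : x ∈ O) (hx' : x ∈ O') {c : ℝ}
    (hc : ∀ a, θ' a x = c • θ a x) (cov : Connection n M)
    (hcov : ∀ (O : Set M) (Y : VField n M), IsOpen O → IsSectionOn S.Q Y O →
      ∀ x ∈ O, ∀ v, cov Y x v ∈ S.Q x) :
    S.connectionMatrix θ' cov ε' x = fun k => ∑ l, (c * S.transition θ ε ε' x l k) •
      ((S.transition θ ε ε' x)ᵀ * S.connectionMatrix θ cov ε x l * S.transition θ ε ε' x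
        + (S.transition θ ε ε' x)ᵀ * S.dTransition θ ε ε' x l) := by
  have hd := mdifferentiableAt_transition hθ hO hO' hε hε' hx hx'
  have hεd := fun i => (hε.isSection i).1.mdifferentiableAt hO hx
  have hεd' := fun i => (hε'.isSection i).1.mdifferentiableAt hO' hx'
  have hs := transition_sum hθ hT hTn hε hε' hx hx'
  have hcovε' : ∀ (j : QuatModel.Idx n) (v : TangentSpace (𝓡 (4 * n + 3)) x), cov (ε' j) x v
      = ∑ p, (S.transition θ ε ε' x p j • cov (ε p) x v
        + mvfderiv (𝓡 (4 * n + 3)) (fun y => S.transition θ ε ε' y p j) x v • ε p x) := fun j v => by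
    rw [← connection_sum cov Finset.univ (fun p => hd p j) hεd v]
    have h := cov.isCovariantDerivativeOnUniv.congr_of_eventuallyEq (x := x) (hεd' j)
      (MDifferentiableAt.sum_section (s := Finset.univ) fun p _ => (hd p j).smul_section (hεd p))
      univ_mem (by
        filter_upwards [(hO.inter hO').mem_nhds ⟨hx, hx'⟩] with y hy
        exact transition_sum hθ hT hTn hε hε' hy.1 hy.2 j)
    exact congrArg (fun A : TangentSpace (𝓡 (4 * n + 3)) x →L[ℝ]
      TangentSpace (𝓡 (4 * n + 3)) x => A v) h
  funext k
  ext i j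
  have h1 : S.connectionMatrix θ' cov ε' x k i j
      = c * S.leviBilin θ x (cov (ε' j) x (ε' k x)) (ε' i x) :=
    hθ.levi_smul hθ' hT hTn hO hε hx hc (hcov O' _ hO' (hε'.isSection j) x hx' _)
      ((hε'.isSection i).2 x hx')
  have h2 : ∀ l, S.leviBilin θ x (cov (ε' j) x (ε l x)) (ε' i x)
      = ((S.transition θ ε ε' x)ᵀ * S.connectionMatrix θ cov ε x l * S.transition θ ε ε' x
        + (S.transition θ ε ε' x)ᵀ * S.dTransition θ ε ε' x l) i j := fun l => by
    rw [hcovε', hs i, Matrix.add_apply, mul_assoc, Matrix.mul_apply, Matrix.mul_apply,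
      ← Finset.sum_add_distrib, map_sum]
    refine Finset.sum_congr rfl fun q _ => ?_
    rw [map_smul, smul_eq_mul, ← mul_add, Matrix.transpose_apply]
    congr 1
    simp only [map_sum, map_add, map_smul, LinearMap.sum_apply, LinearMap.add_apply,
      LinearMap.smul_apply, Finset.sum_add_distrib, leviBilin_apply, hε.orthonormal x hx,
      smul_eq_mul, mul_ite, mul_one, mul_zero, Finset.sum_ite_eq', Finset.mem_univ, if_true]
    congr 1
    rw [Matrix.mul_apply]
    exact Finset.sum_congr rfl fun p _ => mul_comm _ _
  rw [h1, hs k]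
  simp only [map_sum, map_smul, LinearMap.sum_apply, LinearMap.smul_apply, h2, Finset.mul_sum,
    Matrix.sum_apply, Matrix.smul_apply, smul_eq_mul, mul_assoc]

end Transition

/-- The contraction kills sp(n) + sp(1), so ω^{obs} can be replaced by the connection matrix itself.
-/
theorem EHObstructionVanishes.exists_frame {cov : Connection n M}
    (h : S.EHObstructionVanishes θ cov) (x : M) :
    ∃ (O : Set M) (ε : QuatModel.Idx n → VField n M), IsOpen O ∧ x ∈ O ∧
      S.IsAdaptedFrameOn θ ε O ∧ QuatModel.contraction n (S.connectionMatrix θ cov ε x) = 0 := by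
  obtain ⟨O, ε, ω', hO, hx, hε, hω, hE⟩ := h x
  refine ⟨O, ε, hO, hx, hε, ?_⟩
  rw [← hE _ QuatModel.isIntertwiner_contraction, ← sub_eq_zero, ← map_sub]
  ext i
  simp [QuatModel.contraction_apply, QuatModel.obsPart_of_mem_sp_sup_sp1 (hω _).2]

end HyperCRStructure

/-! ### Comparison of the two associated connections -/

namespace HyperCRStructure

variable {n : ℕ} {M : Type*} [TopologicalSpace M]
  [ChartedSpace (EuclideanSpace ℝ (Fin (4 * n + 3))) M] [IsManifold (𝓡 (4 * n + 3)) ∞ M]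
  {S : HyperCRStructure n M} {θ θ' : Fin 3 → OneForm n M} {T T' : Fin 3 → VField n M}
  {ε : QuatModel.Idx n → VField n M} {O : Set M} {x : M}

/-- Symmetry is not visible in the formula for the Levi form; it is recovered here from the
orthonormal frame. -/
theorem levi_frame_comm (hθ : S.IsCompatible θ) (hT : S.IsAdmissibleTriple T)
    (hTn : ∀ a x, θ a x (T a x) = 1) (hε : S.IsAdaptedFrameOn θ ε O) (hx : x ∈ O)
    {v : TangentSpace (𝓡 (4 * n + 3)) x} (hv : v ∈ S.Q x) (i : QuatModel.Idx n) :
    S.levi θ x (ε i x) v = S.levi θ x v (ε i x) := by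
  conv_lhs => rw [hε.eq_sum hθ hT hTn hx hv]
  rw [← leviBilin_apply]
  simp [leviBilin_apply, hε.orthonormal x hx]

/-- Metric compatibility of a connection for which `Levi_θ'` is parallel, in terms of the
connection matrix with respect to a frame which is orthonormal for the conformally related form
`Levi_θ`. -/
theorem connectionMatrix_add_swap (hθ : S.IsCompatible θ) (hθ' : S.IsCompatible θ')
    (hT : S.IsAdmissibleTriple T) (hTn : ∀ a x, θ a x (T a x) = 1) (hO : IsOpen O)
    (hε : S.IsAdaptedFrameOn θ ε O) (hx : x ∈ O) {f : M → ℝ}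
    (hf : ContMDiff (𝓡 (4 * n + 3)) 𝓘(ℝ, ℝ) ∞ f)
    (hc : ∀ a x, θ' a x = Real.exp (2 * f x) • θ a x) {cov : Connection n M}
    (hcov : S.IsAssociatedConnection θ' T' cov) (k i j : QuatModel.Idx n) :
    S.connectionMatrix θ cov ε x k i j + S.connectionMatrix θ cov ε x k j i
      = 2 * mvfderiv (𝓡 (4 * n + 3)) f x (ε k x) * if i = j then 1 else 0 := by
  have hfd : MDifferentiableAt (𝓡 (4 * n + 3)) 𝓘(ℝ, ℝ) f x := (hf x).mdifferentiableAt (by simp)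
  have hQ : ∀ (j : QuatModel.Idx n) v, cov (ε j) x v ∈ S.Q x :=
    fun j => hcov.preserves_Q O _ hO (hε.isSection j) x hx
  have hεQ : ∀ (j : QuatModel.Idx n), ε j x ∈ S.Q x := fun j => (hε.isSection j).2 x hx
  have h := hcov.parallel_g O (ε i) (ε j) hO (hε.isSection i) (hε.isSection j) x hx (ε k x)
  rw [hθ.levi_smul hθ' hT hTn hO hε hx (hc · x) (hQ _ _) (hεQ _),
    hθ.levi_smul hθ' hT hTn hO hε hx (hc · x) (hεQ _) (hQ _ _),
    levi_frame_comm hθ hT hTn hε hx (hQ _ _)] at h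
  -- The frame is orthonormal for Levi_θ on all of O, so the only derivative that survives is that
  -- of e^{2f}.
  have he : (fun y => S.levi θ' y (ε i y) (ε j y))
      =ᶠ[𝓝 x] fun y => Real.exp (2 * f y) * if i = j then 1 else 0 := by
    filter_upwards [hO.mem_nhds hx] with y hy
    rw [hθ.levi_smul hθ' hT hTn hO hε hy (hc · y) ((hε.isSection i).2 y hy)
      ((hε.isSection j).2 y hy), hε.orthonormal y hy]
  have hexp : mvfderiv (𝓡 (4 * n + 3)) (fun y => Real.exp (2 * f y) * if i = j then 1 else 0) x
      (ε k x) = Real.exp (2 * f x) *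
        (2 * mvfderiv (𝓡 (4 * n + 3)) f x (ε k x) * if i = j then 1 else 0) := by
    have hg : HasDerivAt (fun t : ℝ => Real.exp (2 * t) * if i = j then 1 else 0)
        (Real.exp (2 * f x) * 2 * if i = j then 1 else 0) (f x) := by
      simpa using (((hasDerivAt_id (f x)).const_mul 2).exp).mul_const (if i = j then (1 : ℝ) else 0)
    rw [mvfderiv_comp_real hg hfd]
    ring
  rw [mvfderiv_congr he, hexp, ← mul_add] at h
  have := mul_left_cancel₀ (Real.exp_pos _).ne' h
  rw [this, add_comm]
  rfl

/-- The torsion condition in a frame of `Q`. -/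
theorem IsAssociatedConnection.sub_swap (hθ : S.IsCompatible θ) {cov : Connection n M}
    (hcov : S.IsAssociatedConnection θ T cov) {X Y : VField n M} (hO : IsOpen O)
    (hX : IsSectionOn S.Q X O) (hY : IsSectionOn S.Q Y O) (hx : x ∈ O) :
    cov Y x (X x) - cov X x (Y x) = mlieBracket (𝓡 (4 * n + 3)) X Y x
      + ∑ a, (θ a).d x (X x) (Y x) • T a x := by
  have h := hcov.torsion_Q x _ (hX.2 x hx) _ (hY.2 x hx)
  have ht := cov.torsion_apply (hX.1.mdifferentiableAt hO hx) (hY.1.mdifferentiableAt hO hx)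
  -- The connection preserves Q, so θ_a sees only the bracket in the torsion. This identifies the
  -- Q^⊥-part of the torsion with dθ.
  have hform : ∀ a, θ a x (cov.torsion x (X x) (Y x)) = (θ a).d x (X x) (Y x) := fun a => by
    rw [ht, hθ.d_apply_section hO hX hY hx, map_sub, map_sub,
      hθ.mem_Q_iff.1 (hcov.preserves_Q O _ hO hY x hx _) a,
      hθ.mem_Q_iff.1 (hcov.preserves_Q O _ hO hX x hx _) a]
    ring
  rw [QPart, perpPart, sub_eq_zero] at h
  simp only [hform] at h
  rw [← h, ht]
  abel

/-- A tensor is determined by its symmetric part and its torsion. -/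
theorem _root_.QuatModel.koszul {ι : Type*} {D t : ι → ι → ι → ℝ} {s : ι → ι → ι → ℝ}
    (hs : ∀ k i j, D k i j + D k j i = s k i j) (ht : ∀ k i j, D k i j - D j i k = t k j i)
    (k i j : ι) :
    D k i j = (s k i j + s j i k - s i k j + t k j i - t k i j - t j i k) / 2 := by
  linarith [hs k i j, hs j i k, hs i k j, ht k i j, ht k j i, ht j k i]

/-- The canonical condition for θ' is given in a frame orthonormal for Levi_θ'. The frame change
moves it to a frame of θ, where the two connections can be subtracted. -/
theorem contraction_eq_zero (hθ : S.IsCompatible θ) (hθ' : S.IsCompatible θ')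
    (hT : S.IsAdmissibleTriple T) (hTn : ∀ a x, θ a x (T a x) = 1) (hO : IsOpen O)
    (hε : S.IsAdaptedFrameOn θ ε O) (hx : x ∈ O) {c : ℝ} (hc0 : 0 < c)
    (hc : ∀ a, θ' a x = c • θ a x) {cov : Connection n M}
    (hcov : S.IsAssociatedConnection θ' T' cov) (hE : S.EHObstructionVanishes θ' cov) :
    QuatModel.contraction n (S.connectionMatrix θ cov ε x) = 0 := by
  obtain ⟨O', ε', hO', hx', hε', h⟩ := hE.exists_frame x
  rw [connectionMatrix_transition hθ hθ' hT hTn hO hO' hε hε' hx hx' hc cov hcov.preserves_Q] at h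
  exact QuatModel.contraction_eq_zero_of_frame_change hc0
    (transition_orthogonal hθ hθ' hT hTn hO hε hε' hx hx' hc)
    (transition_commute hθ hθ' hT hTn hε hε' hx hx')
    (dTransition_commute hθ hθ' hT hTn hO hO' hε hε' hx hx') h

theorem levi_I_frame (hθ : S.IsCompatible θ) (hT : S.IsAdmissibleTriple T)
    (hTn : ∀ a x, θ a x (T a x) = 1) (hε : S.IsAdaptedFrameOn θ ε O) (hx : x ∈ O)
    {v : TangentSpace (𝓡 (4 * n + 3)) x} (hv : v ∈ S.Q x) (a : Fin 3) (i : QuatModel.Idx n) :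
    S.levi θ x (S.I a x v) (ε i x)
      = (QuatModel.I n a *ᵥ fun j => S.levi θ x v (ε j x)) i := by
  have h : S.I a x v
      = ∑ i, (QuatModel.I n a *ᵥ fun j => S.levi θ x v (ε j x)) i • ε i x := by
    conv_lhs => rw [hε.eq_sum hθ hT hTn hx hv, map_sum]
    simp only [map_smul, hε.I_apply hθ hx a, Finset.smul_sum, smul_smul, Matrix.mulVec, dotProduct,
      Finset.sum_smul]
    rw [Finset.sum_comm]
    simp only [mul_comm]
  rw [h, levi_frame_sum hε hx]

theorem h_frame (hθ : S.IsCompatible θ) (hT : S.IsAdmissibleTriple T)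
    (hTn : ∀ a x, θ a x (T a x) = 1) (hO : IsOpen O) (hε : S.IsAdaptedFrameOn θ ε O) (hx : x ∈ O)
    {v : TangentSpace (𝓡 (4 * n + 3)) x} (hv : v ∈ S.Q x) (j : QuatModel.Idx n) :
    S.h θ x v (ε j x) = (2 * n + 4) * S.levi θ x v (ε j x)
      - (∑ a, (dMatrix θ ε x a * QuatModel.I n a) *ᵥ fun j => S.levi θ x v (ε j x)) j := by
  rw [h, Finset.sum_apply]
  congr 1
  refine Finset.sum_congr rfl fun a _ => ?_
  have hsymm : (dMatrix θ ε x a * QuatModel.I n a)ᵀ = dMatrix θ ε x a * QuatModel.I n a := by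
    rw [Matrix.transpose_mul, IsAdaptedFrameOn.dMatrix_transpose, QuatModel.I_transpose, neg_mul_neg,
      hε.dMatrix_commute hθ hO hx]
  conv_lhs => rw [hε.eq_sum hθ hT hTn hx hv]
  rw [← hsymm, ← OneForm.dBilin_apply]
  simp only [map_sum, map_smul, LinearMap.sum_apply, LinearMap.smul_apply,
    hε.bilin_I_right hθ hx, Matrix.mulVec, dotProduct, Matrix.transpose_apply, smul_eq_mul]
  exact Finset.sum_congr rfl fun i _ => mul_comm _ _

end HyperCRStructure

namespace HyperCRStructure

variable {n : ℕ} {M : Type*} [TopologicalSpace M]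
  [ChartedSpace (EuclideanSpace ℝ (Fin (4 * n + 3))) M] [IsManifold (𝓡 (4 * n + 3)) ∞ M]
  {S : HyperCRStructure n M} {θ θ' : Fin 3 → OneForm n M} {T T' : Fin 3 → VField n M}
  {ε : QuatModel.Idx n → VField n M} {O : Set M} {x : M}

/-- The difference of the connection matrices of two conformally related pseudohermitian
structures. -/
theorem connectionMatrix_sub (hθ : S.IsCompatible θ) (hθ' : S.IsCompatible θ')
    (hT : S.IsAdmissibleTriple T) (hTn : ∀ a x, θ a x (T a x) = 1) (hO : IsOpen O)
    (hε : S.IsAdaptedFrameOn θ ε O) (hx : x ∈ O) {f : M → ℝ}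
    (hf : ContMDiff (𝓡 (4 * n + 3)) 𝓘(ℝ, ℝ) ∞ f)
    (hc : ∀ a x, θ' a x = Real.exp (2 * f x) • θ a x) {cov cov' : Connection n M}
    (hcov : S.IsAssociatedConnection θ T cov) (hcov' : S.IsAssociatedConnection θ' T' cov')
    {w : TangentSpace (𝓡 (4 * n + 3)) x}
    (hTT' : ∀ a, Real.exp (2 * f x) • T' a x = T a x + (2 : ℝ) • S.I a x w)
    (k i j : QuatModel.Idx n) :
    S.connectionMatrix θ cov' ε x k i j - S.connectionMatrix θ cov ε x k i j
      = mvfderiv (𝓡 (4 * n + 3)) f x (ε k x) * (if i = j then 1 else 0)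
        + mvfderiv (𝓡 (4 * n + 3)) f x (ε j x) * (if i = k then 1 else 0)
        - mvfderiv (𝓡 (4 * n + 3)) f x (ε i x) * (if k = j then 1 else 0)
        + ∑ a, (S.levi θ x (S.I a x w) (ε i x) * dMatrix θ ε x a k j
          - dMatrix θ ε x a k i * S.levi θ x (S.I a x w) (ε j x)
          - S.levi θ x (S.I a x w) (ε k x) * dMatrix θ ε x a j i) := by
  let D : QuatModel.Idx n → QuatModel.Idx n → QuatModel.Idx n → ℝ := fun k i j =>
    S.connectionMatrix θ cov' ε x k i j - S.connectionMatrix θ cov ε x k i j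
  let t : QuatModel.Idx n → QuatModel.Idx n → QuatModel.Idx n → ℝ := fun k j i =>
    2 * ∑ a, S.levi θ x (S.I a x w) (ε i x) * dMatrix θ ε x a k j
  let s : QuatModel.Idx n → QuatModel.Idx n → QuatModel.Idx n → ℝ := fun k i j =>
    2 * (mvfderiv (𝓡 (4 * n + 3)) f x (ε k x) * if i = j then 1 else 0)
  have hs : ∀ k i j, D k i j + D k j i = s k i j := fun k i j => by
    have h1 := connectionMatrix_add_swap hθ hθ' hT hTn hO hε hx hf hc hcov' k i j
    -- With f = 0 and θ' = θ the same lemma gives skewness of the connection matrix of θ.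
    have h2 := connectionMatrix_add_swap (f := fun _ => 0) hθ hθ hT hTn hO hε hx contMDiff_const
      (by simp) hcov k i j
    rw [mvfderiv_const] at h2
    simp only [D, s]
    simp only [zero_apply, mul_zero, zero_mul] at h2
    linarith
  have ht : ∀ k i j, D k i j - D j i k = t k j i := fun k i j => by
    have h1 := hcov.sub_swap hθ hO (hε.isSection k) (hε.isSection j) hx
    have h2 := hcov'.sub_swap hθ' hO (hε.isSection k) (hε.isSection j) hx
    have h3 : ∑ a, (θ' a).d x (ε k x) (ε j x) • T' a x
        = ∑ a, (θ a).d x (ε k x) (ε j x) • T a x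
          + ∑ a, ((θ a).d x (ε k x) (ε j x) * 2) • S.I a x w := by
      rw [← Finset.sum_add_distrib]
      refine Finset.sum_congr rfl fun a _ => ?_
      rw [hθ.d_smul hθ' hT hTn hO hε hx (hc · x) ((hε.isSection k).2 x hx)
        ((hε.isSection j).2 x hx), mul_comm (Real.exp _), mul_smul, hTT', smul_add, smul_smul]
    -- The brackets cancel. The factor e^{2f} of dθ'_a turns T'_a into T_a + 2 I_a w, so only the
    -- terms with w remain.
    have h4 : (cov' (ε j) x (ε k x) - cov (ε j) x (ε k x))
        - (cov' (ε k) x (ε j x) - cov (ε k) x (ε j x))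
        = ∑ a, ((θ a).d x (ε k x) (ε j x) * 2) • S.I a x w := by
      rw [h3] at h2
      rw [sub_sub_sub_comm, h1, h2]
      abel
    have h5 := congrArg (fun v => S.leviBilin θ x v (ε i x)) h4
    simp only [map_sub, map_sum, map_smul, LinearMap.sub_apply, LinearMap.sum_apply,
      LinearMap.smul_apply, leviBilin_apply, smul_eq_mul] at h5
    refine h5.trans ?_
    simp only [t, Finset.mul_sum]
    refine Finset.sum_congr rfl fun a _ => ?_
    rw [show dMatrix θ ε x a k j = (θ a).d x (ε k x) (ε j x) from rfl]
    ring
  have h := QuatModel.koszul hs ht k i j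
  simp only [D, s, t] at h
  rw [h]
  simp only [Finset.sum_sub_distrib, eq_comm (a := i) (b := k), mul_comm (dMatrix θ ε x _ k i)]
  ring

/-- The linear equation that relates the canonical triples of two conformally related
pseudohermitian structures. -/
theorem h_eq_neg_mvfderiv (hn : 1 < n) (hθ : S.IsCompatible θ) (hθ' : S.IsCompatible θ')
    (hT : S.IsAdmissibleTriple T) (hTn : ∀ a x, θ a x (T a x) = 1)
    {f : M → ℝ} (hf : ContMDiff (𝓡 (4 * n + 3)) 𝓘(ℝ, ℝ) ∞ f)
    (hc : ∀ a x, θ' a x = Real.exp (2 * f x) • θ a x) {cov cov' : Connection n M}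
    (hcov : S.IsAssociatedConnection θ T cov) (hE : S.EHObstructionVanishes θ cov)
    (hcov' : S.IsAssociatedConnection θ' T' cov') (hE' : S.EHObstructionVanishes θ' cov')
    {w : TangentSpace (𝓡 (4 * n + 3)) x} (hw : w ∈ S.Q x)
    (hTT' : ∀ a, Real.exp (2 * f x) • T' a x = T a x + (2 : ℝ) • S.I a x w)
    {v : TangentSpace (𝓡 (4 * n + 3)) x} (hv : v ∈ S.Q x) :
    S.h θ x w v = -(2 * (n : ℝ) + 1) * mvfderiv (𝓡 (4 * n + 3)) f x v := by
  obtain ⟨O, ε, hO, hx, hε, hΓ⟩ := hE.exists_frame x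
  have hΓ' := contraction_eq_zero hθ hθ' hT hTn hO hε hx (Real.exp_pos _) (hc · x) hcov' hE'
  let G : Fin 3 → Matrix (QuatModel.Idx n) (QuatModel.Idx n) ℝ := fun a =>
    dMatrix θ ε x a * QuatModel.I n a
  let α : QuatModel.Idx n → ℝ := fun i => mvfderiv (𝓡 (4 * n + 3)) f x (ε i x)
  let W : QuatModel.Idx n → ℝ := fun i => S.levi θ x w (ε i x)
  have hGc : ∀ a, G a * QuatModel.I n a = QuatModel.I n a * G a := fun a => by
    simp only [G]
    rw [hε.dMatrix_commute hθ hO hx, mul_assoc, hε.dMatrix_commute hθ hO hx]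
  have hGs : ∀ a, (G a)ᵀ = G a := fun a => by
    simp only [G]
    rw [Matrix.transpose_mul, IsAdaptedFrameOn.dMatrix_transpose, QuatModel.I_transpose, neg_mul_neg,
      hε.dMatrix_commute hθ hO hx]
  have hGI : ∀ a i j, (G a * QuatModel.I n a) i j = dMatrix θ ε x a j i := fun a i j => by
    simp only [G]
    rw [mul_assoc, QuatModel.I_mul_self, mul_neg, mul_one, ← IsAdaptedFrameOn.dMatrix_transpose]
    rfl
  have hlin := QuatModel.contraction_difference G hGs hGc
    (QuatModel.levi_identity (hε.dMatrix_commute hθ hO hx) (hε.dMatrix_succ hθ hO hx)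
      (hε.dMatrix_levi hθ hx)) α W
  have hD : S.connectionMatrix θ cov' ε x - S.connectionMatrix θ cov ε x
      = fun k => α k • 1 + Matrix.vecMulVec ((1 : Matrix (QuatModel.Idx n) _ ℝ).col k) α
        - Matrix.vecMulVec α ((1 : Matrix (QuatModel.Idx n) _ ℝ).col k)
        + ∑ a, (Matrix.vecMulVec (QuatModel.I n a *ᵥ W) ((G a * QuatModel.I n a).col k)
          - Matrix.vecMulVec ((G a * QuatModel.I n a).col k) (QuatModel.I n a *ᵥ W)
          - (QuatModel.I n a *ᵥ W) k • (G a * QuatModel.I n a)) := by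
    funext k
    ext i j
    refine (connectionMatrix_sub hθ hθ' hT hTn hO hε hx hf hc hcov hcov' hTT' k i j).trans ?_
    simp only [levi_I_frame hθ hT hTn hε hx hw, ← hGI]
    simp [Matrix.sum_apply, Matrix.vecMulVec_apply, Matrix.one_apply, α, W, eq_comm (a := k)]
  -- Both contractions vanish, so 6(n-1) times the linear expression is zero; the second goal is
  -- that this factor is nonzero, where n > 1 enters.
  rw [← hD, map_sub, hΓ', hΓ, sub_zero, eq_comm, smul_eq_zero, or_iff_right] at hlin
  · have hframe : ∀ j, S.h θ x w (ε j x)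
        = -(2 * (n : ℝ) + 1) * mvfderiv (𝓡 (4 * n + 3)) f x (ε j x) := fun j => by
      rw [h_frame hθ hT hTn hO hε hx hw]
      have h := congrFun hlin j
      simp only [Pi.sub_apply, Pi.smul_apply, Pi.zero_apply, smul_eq_mul, G, W, α] at h
      linarith
    rw [hε.eq_sum hθ hT hTn hx hv, ← hBilin_apply]
    simp only [map_sum, map_smul, hBilin_apply, hframe, smul_eq_mul, Finset.mul_sum]
    exact Finset.sum_congr rfl fun j _ => by ring
  · have : (1 : ℝ) < n := by exact_mod_cast hn
    have : (n : ℝ) - 1 ≠ 0 := by linarith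
    positivity

end HyperCRStructure

/-! ### The conformal transformation law of the canonical triple -/

theorem proposition3p4 {n : ℕ} (hn : 7 < 4 * n + 3)
    {M : Type*} [TopologicalSpace M] [T2Space M]
    [ChartedSpace (EuclideanSpace ℝ (Fin (4 * n + 3))) M] [IsManifold (𝓡 (4 * n + 3)) ∞ M]
    (S : HyperCRStructure n M) (hS : S.IsUltraPseudoconvex)
    (θ : Fin 3 → OneForm n M) (hθ : S.IsPseudohermitian θ)
    (f : M → ℝ) (hf : ContMDiff (𝓡 (4 * n + 3)) 𝓘(ℝ, ℝ) ∞ f)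
    (θ' : Fin 3 → OneForm n M) (hθ' : ∀ a x, θ' a x = Real.exp (2 * f x) • θ a x)
    (T T' : Fin 3 → VField n M)
    (hT : S.IsCanonicalTriple θ T) (hT' : S.IsCanonicalTriple θ' T') :
    ∃ W : VField n M, IsSectionOn S.Q W Set.univ ∧
      (∀ x, ∀ v ∈ S.Q x,
        S.h θ x (W x) v = -(2 * (n : ℝ) + 1) * mvfderiv (𝓡 (4 * n + 3)) f x v) ∧
      (∀ W' : VField n M, (∀ x, W' x ∈ S.Q x) →
        (∀ x, ∀ v ∈ S.Q x,
          S.h θ x (W' x) v = -(2 * (n : ℝ) + 1) * mvfderiv (𝓡 (4 * n + 3)) f x v) →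
        W' = W) ∧
      ∀ a x, T' a x = Real.exp (-(2 * f x)) • (T a x + (2 : ℝ) • S.I a x (W x)) := by
  obtain ⟨hθc, -⟩ := hθ
  obtain ⟨hTa, hTn, cov, hcov, hE⟩ := hT
  obtain ⟨hTa', hTn', cov', hcov', hE'⟩ := hT'
  have hc : ContMDiff (𝓡 (4 * n + 3)) 𝓘(ℝ, ℝ) ∞ fun x => Real.exp (2 * f x) :=
    Real.contDiff_exp.contMDiff.comp (contMDiff_const.mul hf)
  have hc0 : ∀ x, Real.exp (2 * f x) ≠ 0 := fun x => (Real.exp_pos _).ne'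
  have hθc' := hθc.rescale hc hc0 hθ'
  obtain ⟨W, hW, hWT⟩ := HyperCRStructure.IsAdmissibleTriple.exists_section hθc hc hc0 hθ' hTa hTn
    hTa' hTn'
  have heq : ∀ x, ∀ v ∈ S.Q x,
      S.h θ x (W x) v = -(2 * (n : ℝ) + 1) * mvfderiv (𝓡 (4 * n + 3)) f x v := fun x v hv =>
    HyperCRStructure.h_eq_neg_mvfderiv (by omega) hθc hθc' hTa hTn hf hθ' hcov hE hcov' hE'
      (hW.2 x trivial) (hWT · x) hv
  refine ⟨W, hW, heq, fun W' hW'Q hW' => funext fun x => ?_, fun a x => ?_⟩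
  -- The difference of two solutions lies in Q and is h-orthogonal to Q, so ultra-pseudoconvexity
  -- makes it zero.
  · obtain ⟨O, ε, hO, hx, hε, -⟩ := hE.exists_frame x
    refine sub_eq_zero.1 (hS.eq_zero hθc hTa hTn hO hε hx
      (sub_mem (hW'Q x) (hW.2 x trivial)) fun v hv => ?_)
    rw [← HyperCRStructure.hBilin_apply, map_sub, LinearMap.sub_apply,
      HyperCRStructure.hBilin_apply, HyperCRStructure.hBilin_apply, hW' x v hv, heq x v hv, sub_self]
  · rw [← hWT, smul_smul, ← Real.exp_add, neg_add_cancel, Real.exp_zero, one_smul]
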